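/- **Definitions.** Let $n\ge 1$ and let $\pi=[\pi(1)\,\dots\,\pi(n)]$ be a permutation of $\{1,\dots,n\}$. A *pointer* is a pair $p^*=(p,p+1)$, $1\le p\le n-1$; it is identified with the number $p$. The *pointer word* of $\pi$ is obtained by replacing every entry $a$ by the two pointers $(a-1,a),(a,a+1)$ and deleting $(0,1)$ and $(n,n+1)$. Two distinct pointers $p,q$ are *compatible* (form a *valid pointer context*) in $\pi$ if they appear in the pointer word in the order $p\dots q\dots p\dots q$ or $q\dots p\dots q\dots p$; valid pointer contexts are counted as unordered pairs. In that case $\mathbf{cds}_{p,q}(\pi)$ is the permutation obtained by exchanging the block of entries between the first and the second of these four occurrences with the block between the third and the fourth. A *fixed point* is a permutation without valid pointer contexts; put $\sigma_{n,p}=[p+1\ \dots\ n\ 1\ \dots\ p]$. There is an *adjacency* about $p$ if the entry $p$ is immediately followed by $p+1$. Let $C_\pi=(\pi(n)\ \pi(n-1)\ \dots\ \pi(1)\ 0)\circ(0\ 1\ \dots\ n)$. The *strategic pile* $\mathrm{SP}(\pi)$ is the set of numbers after $n$ and before $0$ in the cycle of $C_\pi$ containing both $n$ and $0$ (empty if there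 is no such cycle). A permutation of even length $2n$ has *maximal strategic pile* if $|\mathrm{SP}(\pi)|=2n-1$; $\mathcal M_{2n}$ is the set of these. For $A\subseteq\mathrm{SP}(\pi)$, the game $\mathrm{CDS}(\pi,A)$ is played as follows: ONE and TWO alternately, ONE first, apply $\mathbf{cds}$ for a valid pointer context of their choice to the current permutation, until a fixed point is reached; ONE wins if this is $\sigma_{n,a}$ for some $a\in A$, otherwise TWO wins. For a set $P$ of pointers, $\pi$ is *$P$-good* if (1) any two distinct pointers in $P$ are compatible; (2) for all $p,q\in P$ and every pointer $r\ne p,q$, $r$ is compatible with $p$ if and only if it is compatible with $q$; (3) every pointer $p$ without an adjacency about it satisfies $p\in\mathrm{SP}(\pi)$. **Theorem.** 1. Let $\pi\in S_n$ be $P$-good, $|\mathrm{SP}(\pi)|=k$, and let $c=k-|P|\ge 0$. If $|P|>3c$ and $A\subseteq\mathrm{SP}(\pi)$ satisfies $|A|\ge\lfloor k/2\rfloor+1+2c$, then ONE has a winning strategy in $\mathrm{CDS}(\pi,A)$. 2. Let $b>0$ be an integer, let $n$ satisfy $2n-1-b>3b$, and let $\pi\in\mathcal M_{2n}$ have at least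 $\binom{2n-1}{2}-b$ valid pointer contexts. If $A\subseteq\mathrm{SP}(\pi)$ satisfies $|A|\ge n+2b$, then ONE has a winning strategy in $\mathrm{CDS}(\pi,A)$. 3. Let $b>0$ be an integer. For every real $r>1/2$ there is an $N$ such that for all $n\ge N$: if $\pi\in\mathcal M_{2n}$ has at least $\binom{2n-1}{2}-b$ valid pointer contexts and $A\subseteq\mathrm{SP}(\pi)$ satisfies $|A|\ge r\,|\mathrm{SP}(\pi)|$, then ONE has a winning strategy in $\mathrm{CDS}(\pi,A)$. -/

import Mathlib

/-!
Permutations of `{1, …, n}` are taken from `Equiv.Perm (Fin n)` (with `i : Fin n` standing for the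
number `i + 1`) and are handled through their one-line notation `[π(1), …, π(n)] : List ℕ`.
The pointer `p* = (p, p + 1)` is represented by the natural number `p`.
-/

namespace ContextSwap

/-- The one-line notation `[π(1), …, π(n)]`, with entries in `{1, …, n}`. -/
def oneLine {n : ℕ} (π : Equiv.Perm (Fin n)) : List ℕ :=
  List.ofFn fun i => (π i : ℕ) + 1

/-- The pointers `p* = (p, p + 1)`, `1 ≤ p ≤ n - 1`. -/
def pointers (n : ℕ) : Finset ℕ := Finset.Ico 1 n

/-- The pointer word: every entry `a` is replaced by its left pointer `(a - 1, a)` followed by its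
right pointer `(a, a + 1)`, and then `(0, 1)` and `(n, n + 1)` are removed. -/
def pointerWord (w : List ℕ) : List ℕ :=
  (w.flatMap fun a => [a - 1, a]).filter fun p => decide (0 < p ∧ p < w.length)

/-- `p` and `q` are compatible, that is, `(p, q)` is a valid pointer context: they appear in the
order `p … q … p … q` or `q … p … q … p` in the pointer word. -/
def Compatible (w : List ℕ) (p q : ℕ) : Prop :=
  p ≠ q ∧ (List.Sublist [p, q, p, q] (pointerWord w) ∨ List.Sublist [q, p, q, p] (pointerWord w))

open Classical in
/-- The number of valid pointer contexts (unordered pairs of pointers). -/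
noncomputable def numContexts (w : List ℕ) : ℕ :=
  ((pointers w.length ×ˢ pointers w.length).filter
    fun x => x.1 < x.2 ∧ Compatible w x.1 x.2).card

/-- The pointer `p` occurs just to the right of the entry `p` and just to the left of the entry
`p + 1`. This is the number of entries to the left of its first occurrence. -/
def firstCut (w : List ℕ) (p : ℕ) : ℕ := min (w.idxOf p + 1) (w.idxOf (p + 1))

/-- The number of entries to the left of the second occurrence of the pointer `p`. -/
def secondCut (w : List ℕ) (p : ℕ) : ℕ := max (w.idxOf p + 1) (w.idxOf (p + 1))

/-- The context directed swap: the four occurrences of `p` and `q` cut the permutation into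
`α | β | γ | δ | ε`, and the blocks `β` and `δ` are exchanged, which gives `α δ γ β ε`.
It is only used for valid pointer contexts. -/
def cds (p q : ℕ) (w : List ℕ) : List ℕ :=
  let a := min (firstCut w p) (firstCut w q)
  let b := max (firstCut w p) (firstCut w q)
  let c := min (secondCut w p) (secondCut w q)
  let d := max (secondCut w p) (secondCut w q)
  w.take a ++ (w.take d).drop c ++ (w.take c).drop b ++ (w.take b).drop a ++ w.drop d

/-- A fixed point of `cds`: there is no valid pointer context. -/
def IsFixedPoint (w : List ℕ) : Prop := ∀ p q : ℕ, ¬ Compatible w p q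

/-- The permutation `[p + 1, …, n, 1, …, p]`. -/
def sigma (n p : ℕ) : List ℕ := List.range' (p + 1) (n - p) ++ List.range' 1 p

/-- The cycle `X_n = (0 1 2 … n)`. -/
def cycleX (n : ℕ) : Equiv.Perm ℕ := (List.range (n + 1)).formPerm

/-- The cycle `Y_π = (a_n a_{n-1} … a_1 0)`, where `π = [a_1, …, a_n]`. -/
def cycleY (w : List ℕ) : Equiv.Perm ℕ := ((0 :: w).reverse).formPerm

/-- The permutation `C_π = Y_π ∘ X_n`. -/
def cycleC (w : List ℕ) : Equiv.Perm ℕ := cycleY w * cycleX w.length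

open Classical in
/-- The strategic pile: the numbers that appear after `n` and before `0` in the cycle of `C_π`
that contains `n` and `0` (empty if there is no such cycle). Here `m` is the number of steps
from `n` to `0` along the cycle. -/
noncomputable def strategicPile (w : List ℕ) : Finset ℕ :=
  (Finset.range (w.length + 1)).filter fun x =>
    ∃ m i : ℕ, (cycleC w ^ m) w.length = 0 ∧ (∀ j < m, (cycleC w ^ j) w.length ≠ 0) ∧
      0 < i ∧ i < m ∧ (cycleC w ^ i) w.length = x

/-- Maximal strategic pile: `n - 1` elements if `n` is even, `n - 2` elements if `n` is odd. -/
def HasMaximalPile (w : List ℕ) : Prop :=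
  (Even w.length ∧ (strategicPile w).card + 1 = w.length) ∨
    (Odd w.length ∧ (strategicPile w).card + 2 = w.length)

/-- There is an adjacency about the pointer `p`: the entry `p` is directly followed by `p + 1`. -/
def HasAdjacency (w : List ℕ) (p : ℕ) : Prop := List.IsInfix [p, p + 1] w

/-- The permutation is `P`-good. (The last entry of `sigma n p` is `p`.) -/
structure IsGood (w : List ℕ) (P : Finset ℕ) : Prop where
  pairwise : ∀ p ∈ P, ∀ q ∈ P, p ≠ q → Compatible w p q
  same : ∀ p ∈ P, ∀ q ∈ P, ∀ r ∈ pointers w.length, r ≠ p → r ≠ q →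
    (Compatible w r p ↔ Compatible w r q)
  pile : ∀ p ∈ pointers w.length, ¬ HasAdjacency w p → p ∈ strategicPile w

/-- A strategy of ONE assigns a pair of pointers to the current position and to the list of all
earlier positions (latest first). -/
abbrev Strategy : Type := List ℕ → List (List ℕ) → ℕ × ℕ

/-- `Play f w₀ w h`: in a play of the `cds` game from `w₀` in which ONE follows `f`, the current
position can be `w` with list of earlier positions `h` (latest first). ONE moves first, so it is
her turn if and only if the length of `h` is even. -/
inductive Play (f : Strategy) (w₀ : List ℕ) : List ℕ → List (List ℕ) → Prop
  | start : Play f w₀ w₀ []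
  | one (w : List ℕ) (h : List (List ℕ)) : Play f w₀ w h → Even h.length →
      Compatible w (f w h).1 (f w h).2 → Play f w₀ (cds (f w h).1 (f w h).2 w) (w :: h)
  | two (w : List ℕ) (h : List (List ℕ)) (p q : ℕ) : Play f w₀ w h → Odd h.length →
      Compatible w p q → Play f w₀ (cds p q w) (w :: h)

/-- ONE has a winning strategy in `CDS(π, A)`: following it she always has a legal move when it is
her turn and the position is not a fixed point, and every fixed point at which a play stops is
`[a + 1, …, n, 1, …, a]` for some `a ∈ A`. (Every move creates new adjacencies and none is ever
destroyed, so all plays are finite.) -/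
def OneHasWinningStrategy (w₀ : List ℕ) (A : Finset ℕ) : Prop :=
  ∃ f : Strategy, ∀ (w : List ℕ) (h : List (List ℕ)), Play f w₀ w h →
    (Even h.length → ¬ IsFixedPoint w → Compatible w (f w h).1 (f w h).2) ∧
      (IsFixedPoint w → ∃ a ∈ A, w = sigma w₀.length a)

end ContextSwap

/-! Interlacing of pointers is a matrix `m` over `ZMod 2`, and a swap about `p`, `q` acts on it as a
pivot: for `r`, `s` other than `p`, `q`, the entry `m(r,s)` changes by `m(p,r)m(q,s) + m(q,r)m(p,s)`
(`IsArr.inter_swapBlocks`). On the cycle permutation the same swap merely bypasses `p` and `q`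
(`IsArr.cycleC_swapBlocks`). So both get adjacencies and leave the strategic pile, and a path from
`n` to `0` survives with nonempty interior.

Goodness is inherited: members of `P` are twins with equal rows, so for two of them the correction
is twice one product, hence zero (`IsGood.move`). By condition (3) every playable pointer lies in
the pile. Each move therefore deletes exactly two pile elements, and play stops precisely when one
element `a` is left. A pile element without partners forces the path `n → a → 0`, and at a fixed
point the permutation is then `sigma n a`. What remains is a game of deleting pairs from a set, in
which ONE wants the survivor to lie in `A`.

If the pile equals `P`, every pair may be deleted; ONE deletes elements outside `A`, and a majority
suffices. If `c > 0` pile elements lie outside `P`, ONE plays one of these. A round then costs at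
most four elements of `A` and three of `P`, while the thresholds `k/2 + 2c` and `3c` fall by at
least four and three (`OnePosition.exists_move`).

For a maximal pile in even length, the largest entry stands directly before `1`, and a row-sum
computation shows that every pointer has an even number of partners. A pointer that misses a partner
misses at least two, so `b` missing pairs spoil at most `b` pointers, and the others form a good set
with `c ≤ b`. -/

namespace ContextSwap

open Equiv

/-! ### Permutations as words, and the cuts between their entries -/

/-- `w` is the one-line notation of a permutation of `{1, …, w.length}`. -/
structure IsArr (w : List ℕ) : Prop where
  nodup : w.Nodup
  mem : ∀ x, x ∈ w ↔ 1 ≤ x ∧ x ≤ w.length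

/-- The number of entries to the left of the cut just to the right of the entry `y`
(the entry `0` is placed in front of `w`). -/
def rightCut (w : List ℕ) (y : ℕ) : ℕ := (0 :: w).idxOf y

/-- The number of entries to the left of the cut just to the left of the entry `x + 1`. -/
def leftCut (w : List ℕ) (x : ℕ) : ℕ := w.idxOf (x + 1)

theorem isArr_oneLine {n : ℕ} (π : Equiv.Perm (Fin n)) : IsArr (oneLine π) := by
  refine ⟨?_, fun x => ?_⟩
  · rw [oneLine, List.nodup_ofFn]
    intro i j h
    apply π.injective
    apply Fin.ext
    simpa using h
  · rw [oneLine, List.mem_ofFn, List.length_ofFn]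
    constructor
    · rintro ⟨i, rfl⟩
      have := (π i).2
      omega
    · rintro ⟨h1, h2⟩
      refine ⟨π.symm ⟨x - 1, by omega⟩, ?_⟩
      simp only [Equiv.apply_symm_apply]
      omega

theorem length_oneLine {n : ℕ} (π : Equiv.Perm (Fin n)) : (oneLine π).length = n := by
  simp [oneLine]

theorem leftCut_le (w : List ℕ) (x : ℕ) : leftCut w x ≤ w.length := List.idxOf_le_length

theorem rightCut_zero (w : List ℕ) : rightCut w 0 = 0 := by
  simp [rightCut]

theorem rightCut_eq (w : List ℕ) {y : ℕ} (h : y ≠ 0) : rightCut w y = w.idxOf y + 1 := by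
  rw [rightCut, List.idxOf_cons_ne _ (Ne.symm h)]

namespace IsArr

variable {w : List ℕ}

theorem idxOf_lt (hw : IsArr w) {x : ℕ} (h1 : 1 ≤ x) (h2 : x ≤ w.length) :
    w.idxOf x < w.length :=
  List.idxOf_lt_length_iff.2 ((hw.mem x).2 ⟨h1, h2⟩)

theorem zero_notMem (hw : IsArr w) : 0 ∉ w := fun h => by
  have := (hw.mem 0).1 h
  omega

theorem nodup_cons (hw : IsArr w) : (0 :: w).Nodup :=
  List.nodup_cons.2 ⟨hw.zero_notMem, hw.nodup⟩

theorem mem_cons (hw : IsArr w) {y : ℕ} : y ∈ 0 :: w ↔ y ≤ w.length := by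
  rw [List.mem_cons, hw.mem]
  omega

theorem rightCut_le (hw : IsArr w) {y : ℕ} (h : y ≤ w.length) : rightCut w y ≤ w.length := by
  have := List.idxOf_lt_length_iff.2 (hw.mem_cons.2 h)
  rw [List.length_cons] at this
  exact Nat.le_of_lt_succ this

theorem leftCut_lt (hw : IsArr w) {x : ℕ} (h : x < w.length) : leftCut w x < w.length :=
  hw.idxOf_lt (by omega) h

/-- The entry `w.length + 1` is absent, so `idxOf` returns the length. With this default both kinds
of cut are bijections of `{0, …, w.length}`. -/
theorem leftCut_length (hw : IsArr w) : leftCut w w.length = w.length := by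
  rw [leftCut, List.idxOf_eq_length_iff, hw.mem]
  omega

theorem rightCut_inj (hw : IsArr w) {x y : ℕ} (hx : x ≤ w.length)
    (h : rightCut w x = rightCut w y) : x = y :=
  (List.idxOf_inj (hw.mem_cons.2 hx)).1 h

theorem leftCut_inj (hw : IsArr w) {x y : ℕ} (hx : x ≤ w.length) (hy : y ≤ w.length)
    (h : leftCut w x = leftCut w y) : x = y := by
  rcases hx.eq_or_lt with rfl | hx'
  · rcases hy.eq_or_lt with rfl | hy'
    · rfl
    · have := hw.leftCut_lt hy'
      rw [hw.leftCut_length] at h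
      omega
  · have := (List.idxOf_inj ((hw.mem (x + 1)).2 ⟨by omega, hx'⟩)).1 h
    omega

theorem exists_rightCut (hw : IsArr w) {t : ℕ} (ht : t ≤ w.length) :
    ∃ y, y ≤ w.length ∧ rightCut w y = t := by
  have ht' : t < (0 :: w).length := by simpa using Nat.lt_succ_of_le ht
  exact ⟨(0 :: w)[t], hw.mem_cons.1 (List.getElem_mem _), hw.nodup_cons.idxOf_getElem t ht'⟩

theorem exists_leftCut (hw : IsArr w) {t : ℕ} (ht : t ≤ w.length) :
    ∃ x, x ≤ w.length ∧ leftCut w x = t := by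
  rcases ht.eq_or_lt with rfl | ht'
  · exact ⟨w.length, le_rfl, hw.leftCut_length⟩
  · have h := (hw.mem w[t]).1 (List.getElem_mem _)
    refine ⟨w[t] - 1, by omega, ?_⟩
    rw [leftCut, Nat.sub_add_cancel h.1]
    exact hw.nodup.idxOf_getElem t ht'

end IsArr

/-! ### Compatibility as a parity of inversions -/

/-- `[x < y]` modulo two. -/
def ltInd (x y : ℕ) : ZMod 2 := if x < y then 1 else 0

/-- The parity of the number of pairs consisting of an occurrence of `p` and a later occurrence
of `q`; the right pointer of the entry at a cut `t` has position `2 * t`, the left pointer of the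
next entry has position `2 * t + 1`. -/
def inter (w : List ℕ) (p q : ℕ) : ZMod 2 :=
  ltInd (2 * rightCut w p) (2 * rightCut w q) + ltInd (2 * rightCut w p) (2 * leftCut w q + 1) +
    (ltInd (2 * leftCut w p + 1) (2 * rightCut w q) +
      ltInd (2 * leftCut w p + 1) (2 * leftCut w q + 1))

theorem cons_sublist_iff_getElem? (a : ℕ) (t l : List ℕ) :
    List.Sublist (a :: t) l ↔ ∃ i, l[i]? = some a ∧ List.Sublist t (l.drop (i + 1)) := by
  constructor
  · intro h
    obtain ⟨r₁, r₂, rfl, ha, ht⟩ := List.cons_sublist_iff.1 h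
    obtain ⟨i, hi, rfl⟩ := List.getElem_of_mem ha
    refine ⟨i, by simp [List.getElem?_append, hi], ?_⟩
    rw [List.drop_append_of_le_length (by omega)]
    exact ht.trans (List.sublist_append_right _ _)
  · rintro ⟨i, hi, ht⟩
    obtain ⟨hi', rfl⟩ := List.getElem?_eq_some_iff.1 hi
    have h := ht.cons_cons l[i]
    rw [List.getElem_cons_drop] at h
    exact h.trans (List.drop_sublist _ _)

theorem getElem?_flatMap_pointers (w : List ℕ) (k : ℕ) :
    (w.flatMap fun a => [a - 1, a])[k]? =
      if k % 2 = 0 then w[k / 2]?.map (· - 1) else w[k / 2]? := by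
  induction w generalizing k with
  | nil => simp
  | cons a w ih =>
    rcases k with _ | _ | k
    · simp
    · simp
    · have h1 : (k + 1 + 1) % 2 = k % 2 := by omega
      have h2 : (k + 1 + 1) / 2 = k / 2 + 1 := by omega
      rw [h1, h2]
      simpa using ih k

theorem IsArr.getElem?_letter {w : List ℕ} (hw : IsArr w) {p : ℕ} (h1 : 1 ≤ p)
    (h2 : p < w.length) (k : ℕ) : (w.flatMap fun a => [a - 1, a])[k]? = some p ↔
      k + 1 = 2 * rightCut w p ∨ k = 2 * leftCut w p := by
  have key : ∀ x i, 1 ≤ x → x ≤ w.length → (w[i]? = some x ↔ i = w.idxOf x) := by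
    intro x i hx1 hx2
    constructor
    · intro h
      obtain ⟨hi', rfl⟩ := List.getElem?_eq_some_iff.1 h
      exact (hw.nodup.idxOf_getElem i hi').symm
    · rintro rfl
      have := hw.idxOf_lt hx1 hx2
      rw [List.getElem?_eq_getElem this, List.getElem_idxOf]
  rw [getElem?_flatMap_pointers, rightCut_eq _ (by omega), leftCut]
  split_ifs with hk
  · have : Option.map (· - 1) w[k / 2]? = some p ↔ w[k / 2]? = some (p + 1) := by
      rw [Option.map_eq_some_iff]
      constructor
      · rintro ⟨a, ha, rfl⟩
        have := (hw.mem a).1 (List.mem_of_getElem? ha)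
        rw [ha]
        congr 1
        omega
      · intro h
        exact ⟨_, h, by simp⟩
    rw [this, key _ _ (by omega) (by omega)]
    omega
  · rw [key _ _ h1 h2.le]
    omega

theorem sublist_four_iff (a b c d : ℕ) (l : List ℕ) :
    List.Sublist [a, b, c, d] l ↔ ∃ i j k m : ℕ, i < j ∧ j < k ∧ k < m ∧
      l[i]? = some a ∧ l[j]? = some b ∧ l[k]? = some c ∧ l[m]? = some d := by
  simp only [cons_sublist_iff_getElem?, List.drop_drop, List.getElem?_drop, List.nil_sublist,
    and_true]
  constructor
  · rintro ⟨i, hi, j, hj, k, hk, m, hm⟩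
    exact ⟨i, _, _, _, by omega, by omega, by omega, hi, hj, hk, hm⟩
  · rintro ⟨i, j, k, m, hij, hjk, hkm, hi, hj, hk, hm⟩
    refine ⟨i, hi, j - i - 1, ?_, k - j - 1, ?_, m - k - 1, ?_⟩
    · rwa [show i + 1 + (j - i - 1) = j by omega]
    · rwa [show i + 1 + (j - i - 1 + 1) + (k - j - 1) = k by omega]
    · rwa [show i + 1 + (j - i - 1 + 1) + (k - j - 1 + 1) + (m - k - 1) = m by omega]

theorem IsArr.sublist_pointerWord {w : List ℕ} (hw : IsArr w) (p q : ℕ) :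
    List.Sublist [p, q, p, q] (pointerWord w) ↔ (p ∈ pointers w.length ∧ q ∈ pointers w.length) ∧
      ∃ i j k m, i < j ∧ j < k ∧ k < m ∧
        (i = 2 * rightCut w p ∨ i = 2 * leftCut w p + 1) ∧
        (j = 2 * rightCut w q ∨ j = 2 * leftCut w q + 1) ∧
        (k = 2 * rightCut w p ∨ k = 2 * leftCut w p + 1) ∧
        (m = 2 * rightCut w q ∨ m = 2 * leftCut w q + 1) := by
  -- Filtering discards only letters that are not pointers, so the subword may be sought in the
  -- unfiltered word, where positions are explicit.
  have hf : List.Sublist [p, q, p, q] (pointerWord w) ↔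
      (p ∈ pointers w.length ∧ q ∈ pointers w.length) ∧
        List.Sublist [p, q, p, q] (w.flatMap fun a => [a - 1, a]) := by
    rw [pointerWord]
    constructor
    · intro h
      have hp := List.of_mem_filter (h.subset (by simp : p ∈ [p, q, p, q]))
      have hq := List.of_mem_filter (h.subset (by simp : q ∈ [p, q, p, q]))
      simp only [decide_eq_true_eq] at hp hq
      simp only [pointers, Finset.mem_Ico]
      exact ⟨⟨hp, hq⟩, h.trans List.filter_sublist⟩
    · rintro ⟨⟨hp, hq⟩, h⟩
      simp only [pointers, Finset.mem_Ico] at hp hq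
      have := h.filter fun p => decide (0 < p ∧ p < w.length)
      rwa [List.filter_eq_self.2] at this
      intro a ha
      simp only [List.mem_cons, List.not_mem_nil, or_false] at ha
      rw [decide_eq_true_eq]
      rcases ha with rfl | rfl | rfl | rfl
      exacts [hp, hq, hp, hq]
  rw [hf]
  refine and_congr_right fun ⟨hp, hq⟩ => ?_
  simp only [pointers, Finset.mem_Ico] at hp hq
  simp only [sublist_four_iff, hw.getElem?_letter hp.1 hp.2, hw.getElem?_letter hq.1 hq.2]
  constructor
  · rintro ⟨i, j, k, m, h⟩
    -- The positions `2 * t` and `2 * t + 1` exceed list indices by one, because of the entry `0`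
    -- put in front.
    exact ⟨i + 1, j + 1, k + 1, m + 1, by omega⟩
  · have h1 := rightCut_eq w (y := p) (by omega)
    have h2 := rightCut_eq w (y := q) (by omega)
    rintro ⟨i, j, k, m, h⟩
    exact ⟨i - 1, j - 1, k - 1, m - 1, by omega⟩

theorem ltInd_eq_one {x y : ℕ} (h : x < y) : ltInd x y = 1 := if_pos h

theorem ltInd_eq_zero {x y : ℕ} (h : y ≤ x) : ltInd x y = 0 := if_neg (by omega)

/-- Two pairs of distinct numbers interlace if and only if the number of inversions is odd. -/
theorem ltInd_sum_eq_one {r l s m : ℕ} (h1 : r ≠ s) (h2 : r ≠ m) (h3 : l ≠ s) (h4 : l ≠ m) :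
    ltInd r s + ltInd r m + (ltInd l s + ltInd l m) = 1 ↔
      ((min r l < min s m ∧ min s m < max r l ∧ max r l < max s m) ∨
        (min s m < min r l ∧ min r l < max s m ∧ max s m < max r l)) := by
  have e2 : (1 + 1 : ZMod 2) = 0 := rfl
  rcases lt_or_gt_of_ne h1 with a1 | a1 <;> rcases lt_or_gt_of_ne h2 with a2 | a2 <;>
    rcases lt_or_gt_of_ne h3 with a3 | a3 <;> rcases lt_or_gt_of_ne h4 with a4 | a4 <;>
    simp only [ltInd, a1, a2, a3, a4, a1.not_gt, a2.not_gt, a3.not_gt, a4.not_gt, if_true,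
      if_false, e2, add_zero, zero_add, zero_ne_one, false_iff, true_iff] <;>
    omega

theorem IsArr.compatible_iff {w : List ℕ} (hw : IsArr w) (p q : ℕ) :
    Compatible w p q ↔ p ≠ q ∧ p ∈ pointers w.length ∧ q ∈ pointers w.length ∧
      inter w p q = 1 := by
  rw [Compatible, hw.sublist_pointerWord, hw.sublist_pointerWord]
  refine and_congr_right fun hpq => ?_
  by_cases hp : p ∈ pointers w.length
  swap
  · simp [hp]
  by_cases hq : q ∈ pointers w.length
  swap
  · simp [hq]
  simp only [hp, hq, and_self, true_and]
  simp only [pointers, Finset.mem_Ico] at hp hq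
  have n1 : rightCut w p ≠ rightCut w q := fun h => hpq (hw.rightCut_inj hp.2.le h)
  have n2 : leftCut w p ≠ leftCut w q := fun h => hpq (hw.leftCut_inj hp.2.le hq.2.le h)
  rw [inter, ltInd_sum_eq_one (by omega) (by omega) (by omega) (by omega)]
  constructor
  · rintro (⟨i, j, k, m, h⟩ | ⟨i, j, k, m, h⟩) <;> omega
  · intro h
    rcases h with h | h
    · exact Or.inl ⟨_, _, _, _, h.1, h.2.1, h.2.2, by omega⟩
    · exact Or.inr ⟨_, _, _, _, h.1, h.2.1, h.2.2, by omega⟩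

theorem Compatible.symm {w : List ℕ} {p q : ℕ} (h : Compatible w p q) : Compatible w q p :=
  ⟨h.1.symm, h.2.symm⟩

theorem Compatible.comm {w : List ℕ} {p q : ℕ} : Compatible w p q ↔ Compatible w q p :=
  ⟨Compatible.symm, Compatible.symm⟩

/-! ### The cycle permutation and the strategic pile -/

/-- `X` takes `x` to `x + 1` cyclically and `Y` takes an entry to its left neighbour in `0 :: w`,
cyclically. So `cycleC w x` is the entry just left of `x + 1`, which translates cycles into cuts. -/
theorem IsArr.cycleC_le {w : List ℕ} (hw : IsArr w) {x : ℕ} (hx : x ≤ w.length) :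
    cycleC w x ≤ w.length ∧ rightCut w (cycleC w x) = leftCut w x := by
  have hX : cycleX w.length x = (x + 1) % (w.length + 1) := by
    have h := List.formPerm_apply_getElem (List.range (w.length + 1)) List.nodup_range x
      (by simpa using Nat.lt_succ_of_le hx)
    simpa [cycleX] using h
  have hY : ∀ y ≤ w.length, ∀ z ≤ w.length, (rightCut w y + 1) % (w.length + 1) = rightCut w z →
      cycleY w z = y := by
    intro y hy z hz h
    rw [cycleY, List.formPerm_reverse, Perm.inv_eq_iff_eq]
    have hy' := List.idxOf_lt_length_iff.2 (hw.mem_cons.2 hy)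
    have hz' := List.idxOf_lt_length_iff.2 (hw.mem_cons.2 hz)
    have := List.formPerm_apply_getElem (0 :: w) hw.nodup_cons _ hy'
    rw [List.getElem_idxOf] at this
    rw [this]
    simp only [rightCut] at h
    simp only [List.length_cons, h, List.getElem_idxOf]
  obtain ⟨y, hy, h⟩ := hw.exists_rightCut (leftCut_le w x)
  have : cycleC w x = y := by
    rw [cycleC, Perm.mul_apply, hX]
    apply hY y hy _ (Nat.le_of_lt_succ (Nat.mod_lt _ (Nat.succ_pos _)))
    rw [h]
    rcases hx.eq_or_lt with rfl | hx'
    · rw [hw.leftCut_length, Nat.mod_self, rightCut_zero]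
    · rw [Nat.mod_eq_of_lt (Nat.succ_lt_succ hx'), rightCut_eq _ (Nat.succ_ne_zero x),
        Nat.mod_eq_of_lt (Nat.succ_lt_succ (hw.leftCut_lt hx'))]
      rfl
  rw [this]
  exact ⟨hy, h⟩

theorem IsArr.cycleC_eq_iff {w : List ℕ} (hw : IsArr w) {x y : ℕ} (hx : x ≤ w.length) :
    cycleC w x = y ↔ y ≤ w.length ∧ rightCut w y = leftCut w x := by
  have h := hw.cycleC_le hx
  constructor
  · rintro rfl
    exact h
  · rintro ⟨h1, h2⟩
    exact hw.rightCut_inj h.1 (h.2.trans h2.symm)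

/-- `y` is reached from `a` by applying `f` at least once, without passing through `0` before. -/
inductive Reach (f : ℕ → ℕ) (a : ℕ) : ℕ → Prop
  | base : Reach f a (f a)
  | step (x : ℕ) : Reach f a x → x ≠ 0 → Reach f a (f x)

theorem reach_perm_iff (f : Perm ℕ) (a x : ℕ) :
    Reach f a x ↔ ∃ i : ℕ, 0 < i ∧ (f ^ i) a = x ∧ ∀ j, 0 < j → j < i → (f ^ j) a ≠ 0 := by
  constructor
  · intro h
    induction h with
    | base => exact ⟨1, one_pos, by simp, by omega⟩
    | step x _ hx ih =>
      obtain ⟨i, hi, rfl, hj⟩ := ih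
      refine ⟨i + 1, by omega, by rw [pow_succ', Perm.mul_apply], fun j h0 h1 => ?_⟩
      rcases (Nat.le_of_lt_succ h1).eq_or_lt with rfl | h2
      exacts [hx, hj j h0 h2]
  · rintro ⟨i, hi, rfl, hj⟩
    induction i with
    | zero => omega
    | succ i ih =>
      rw [pow_succ', Perm.mul_apply]
      rcases Nat.eq_zero_or_pos i with rfl | hi'
      · exact .base
      · exact .step _ (ih hi' fun j h0 h1 => hj j h0 (by omega)) (hj i hi' (by omega))

theorem Reach.closed {f : ℕ → ℕ} {a x : ℕ} (S : ℕ → Prop) (h : Reach f a x) (ha : S a)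
    (hS : ∀ y, S y → S (f y)) : S x := by
  induction h with
  | base => exact hS _ ha
  | step x _ _ ih => exact hS _ ih

/-- `f` with the point `p` bypassed. -/
def bypass (f : ℕ → ℕ) (p x : ℕ) : ℕ := if f x = p then f p else f x

/-- Skipping `p` does not change which other points a walk meets; `p ≠ 0` matters because walks stop
at `0`. -/
theorem reach_bypass_iff {f : ℕ → ℕ} {a p x : ℕ} (hp : p ≠ 0) (hx : x ≠ p) :
    Reach (bypass f p) a x ↔ Reach f a x := by
  constructor
  · intro h
    clear hx
    induction h with
    | base =>
      unfold bypass
      split_ifs with h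
      · exact .step _ (h ▸ .base) hp
      · exact .base
    | step x _ hx ih =>
      unfold bypass
      split_ifs with h
      · exact .step _ (h ▸ .step _ ih hx) hp
      · exact .step _ ih hx
  · intro h
    -- When the original walk stands at `p`, the shortened one is already at `f p`; the induction
    -- must carry both situations.
    have key : (x ≠ p → Reach (bypass f p) a x) ∧ (x = p → Reach (bypass f p) a (f p)) := by
      clear hx
      induction h with
      | base =>
        refine ⟨fun h => ?_, fun h => ?_⟩
        · have : bypass f p a = f a := if_neg h
          exact this ▸ .base
        · have : bypass f p a = f p := if_pos h
          exact this ▸ .base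
      | step x _ hx ih =>
        by_cases hxp : x = p
        · have := ih.2 hxp
          rw [hxp]
          exact ⟨fun _ => this, fun _ => this⟩
        · refine ⟨fun h => ?_, fun h => ?_⟩
          · have : bypass f p x = f x := if_neg h
            exact this ▸ .step _ (ih.1 hxp) hx
          · have : bypass f p x = f p := if_pos h
            exact this ▸ .step _ (ih.1 hxp) hx
    exact key.1 hx

theorem IsArr.reach_le {w : List ℕ} (hw : IsArr w) {x : ℕ} (h : Reach (cycleC w) w.length x) :
    x ≤ w.length :=
  h.closed (· ≤ w.length) le_rfl fun _ hy => (hw.cycleC_le hy).1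

/-- A walk that halts at `0` sees exactly the part of the cycle before `0`, and, unlike powers, it
is suited to bypassing. -/
theorem IsArr.mem_strategicPile_iff {w : List ℕ} (hw : IsArr w) (h0 : w.length ≠ 0) {x : ℕ} :
    x ∈ strategicPile w ↔
      Reach (cycleC w) w.length 0 ∧ Reach (cycleC w) w.length x ∧ x ≠ 0 := by
  simp only [strategicPile, Finset.mem_filter, Finset.mem_range]
  constructor
  · rintro ⟨_, m, i, hm, hj, hi, him, rfl⟩
    refine ⟨(reach_perm_iff _ _ _).2 ⟨m, by omega, hm, fun j _ h => hj j h⟩,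
      (reach_perm_iff _ _ _).2 ⟨i, hi, rfl, fun j _ h => hj j (by omega)⟩, hj i him⟩
  · rintro ⟨hr, hx, hx0⟩
    have hxl := hw.reach_le hx
    obtain ⟨m, hm, hm', hmj⟩ := (reach_perm_iff _ _ _).1 hr
    obtain ⟨i, hi, hi', hij⟩ := (reach_perm_iff _ _ _).1 hx
    refine ⟨by omega, m, i, hm', fun j hj => ?_, hi, ?_, hi'⟩
    · rcases Nat.eq_zero_or_pos j with rfl | hj'
      · simpa using h0
      · exact hmj j hj' hj
    · rcases lt_trichotomy i m with h | rfl | h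
      · exact h
      · exact absurd (hi'.symm.trans hm') hx0
      · exact absurd hm' (hij m hm h)

theorem strategicPile_subset (w : List ℕ) :
    strategicPile w ⊆ pointers w.length := by
  intro x hx
  simp only [strategicPile, Finset.mem_filter, Finset.mem_range] at hx
  obtain ⟨hx, m, i, hm, hj, hi, him, hx'⟩ := hx
  rw [pointers, Finset.mem_Ico]
  have h1 : x ≠ 0 := fun h => hj i him (hx'.trans h)
  have h2 : x ≠ w.length := by
    rintro rfl
    -- A return to `w.length` after `i` steps would bring `0` forward to step `m - i`, against the
    -- minimality of `m`.
    apply hj (m - i) (by omega)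
    rw [← hm]
    conv_rhs => rw [← Nat.sub_add_cancel him.le, pow_add, Perm.mul_apply, hx']
  omega

theorem IsArr.cycleC_length_ne_zero {w : List ℕ} (hw : IsArr w) (h0 : w.length ≠ 0) :
    cycleC w w.length ≠ 0 := by
  intro h
  have := (hw.cycleC_le le_rfl).2
  rw [h, hw.leftCut_length, rightCut_zero] at this
  omega

theorem IsArr.strategicPile_nonempty_iff {w : List ℕ} (hw : IsArr w) (h0 : w.length ≠ 0) :
    (strategicPile w).Nonempty ↔ Reach (cycleC w) w.length 0 := by
  constructor
  · rintro ⟨x, hx⟩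
    exact ((hw.mem_strategicPile_iff h0).1 hx).1
  · intro h
    exact ⟨_, (hw.mem_strategicPile_iff h0).2 ⟨h, .base, hw.cycleC_length_ne_zero h0⟩⟩

theorem length_ne_zero_of_mem_pile {w : List ℕ} {a : ℕ}
    (ha : a ∈ strategicPile w) : w.length ≠ 0 := by
  have := strategicPile_subset w ha
  rw [pointers, Finset.mem_Ico] at this
  omega

theorem reach_ne_of_fixed {f : Perm ℕ} {a p x : ℕ} (h : Reach f a x) (hp : f p = p) (ha : a ≠ p) :
    x ≠ p := by
  induction h with
  | base => exact fun h => ha (f.injective (h.trans hp.symm))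
  | step y _ _ ih => exact fun h => ih (f.injective (h.trans hp.symm))

theorem IsArr.cycleC_ne_of_mem_pile {w : List ℕ} (hw : IsArr w) {p : ℕ}
    (h : p ∈ strategicPile w) : cycleC w p ≠ p := by
  have h1 := strategicPile_subset w h
  rw [pointers, Finset.mem_Ico] at h1
  have h2 := (hw.mem_strategicPile_iff (by omega)).1 h
  exact fun h' => reach_ne_of_fixed h2.2.1 h' (by omega) rfl

/-! ### Adjacencies as fixed points of the cycle permutation -/

theorem IsArr.hasAdjacency_iff {w : List ℕ} (hw : IsArr w) {p : ℕ} (hp : p ∈ pointers w.length) :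
    HasAdjacency w p ↔ leftCut w p = rightCut w p := by
  rw [pointers, Finset.mem_Ico] at hp
  rw [rightCut_eq _ (by omega), leftCut]
  constructor
  · rintro ⟨s, t, h⟩
    have hn := hw.nodup
    rw [← h] at hn ⊢
    simp only [List.append_assoc, List.cons_append, List.nil_append] at hn ⊢
    have h1 := List.nodup_append.1 hn
    have hp1 : p ∉ s := fun h => h1.2.2 _ h _ (by simp) rfl
    have hp2 : p + 1 ∉ s := fun h => h1.2.2 _ h _ (by simp) rfl
    rw [List.idxOf_append_of_notMem hp1, List.idxOf_append_of_notMem hp2]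
    simp
  · intro h
    have h1 := hw.idxOf_lt hp.1 hp.2.le
    have h2 := hw.idxOf_lt (x := p + 1) (by omega) hp.2
    refine ⟨w.take (w.idxOf p), w.drop (w.idxOf p + 2), ?_⟩
    have e1 : w.drop (w.idxOf p) = p :: w.drop (w.idxOf p + 1) := by
      rw [List.drop_eq_getElem_cons h1, List.getElem_idxOf]
    have e2 : w.drop (w.idxOf p + 1) = (p + 1) :: w.drop (w.idxOf p + 2) := by
      rw [← h, List.drop_eq_getElem_cons h2, List.getElem_idxOf, h]
    conv_rhs => rw [← List.take_append_drop (w.idxOf p) w, e1, e2]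
    simp

theorem IsArr.hasAdjacency_iff_cycleC {w : List ℕ} (hw : IsArr w) {p : ℕ}
    (hp : p ∈ pointers w.length) : HasAdjacency w p ↔ cycleC w p = p := by
  rw [hw.hasAdjacency_iff hp]
  rw [pointers, Finset.mem_Ico] at hp
  rw [hw.cycleC_eq_iff hp.2.le]
  constructor
  · exact fun h => ⟨hp.2.le, h.symm⟩
  · exact fun h => h.2.symm

/-- The two letters `p` occupy the consecutive positions `2t`, `2t + 1`. No letter `q` separates
them, so their contributions agree and cancel. -/
theorem inter_eq_zero_of_adjacency {w : List ℕ} (hw : IsArr w) {p q : ℕ}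
    (hp : p ≤ w.length) (hq : q ≤ w.length) (hpq : p ≠ q) (h : leftCut w p = rightCut w p) :
    inter w p q = 0 := by
  have n1 : rightCut w p ≠ rightCut w q := fun h => hpq (hw.rightCut_inj hp h)
  have n2 : leftCut w p ≠ leftCut w q := fun h => hpq (hw.leftCut_inj hp hq h)
  have e : ∀ x : ℕ, x ≠ 2 * leftCut w p → x ≠ 2 * leftCut w p + 1 →
      ltInd (2 * leftCut w p) x = ltInd (2 * leftCut w p + 1) x := by
    intro x h1 h2
    unfold ltInd
    split_ifs <;> first | rfl | omega
  rw [inter, ← h, e (2 * rightCut w q) (by omega) (by omega),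
    e (2 * leftCut w q + 1) (by omega) (by omega)]
  exact CharTwo.add_self_eq_zero _

theorem IsArr.not_hasAdjacency_of_compatible {w : List ℕ} (hw : IsArr w) {p q : ℕ}
    (h : Compatible w p q) : ¬ HasAdjacency w p := by
  rw [hw.compatible_iff] at h
  obtain ⟨h1, h2, h3, h4⟩ := h
  rw [hw.hasAdjacency_iff h2]
  rw [pointers, Finset.mem_Ico] at h2 h3
  intro h
  rw [inter_eq_zero_of_adjacency hw h2.2.le h3.2.le h1 h] at h4
  exact zero_ne_one h4

/-! ### The effect of a swap on cuts -/

/-- Exchange of the blocks of `w` between the cuts `a`, `b` and between the cuts `c`, `d`. -/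
def swapBlocks (a b c d : ℕ) (w : List ℕ) : List ℕ :=
  w.take a ++ (w.take d).drop c ++ (w.take c).drop b ++ (w.take b).drop a ++ w.drop d

/-- The effect of `swapBlocks` on the position of the cut to the left of an entry. -/
def moveLeft (a b c d t : ℕ) : ℕ :=
  if t < a then t else if t < b then t + d - b else if t < c then t + a + d - b - c
  else if t < d then t + a - c else t

/-- The effect of `swapBlocks` on the position of the cut to the right of an entry. -/
def moveRight (a b c d t : ℕ) : ℕ :=
  if t ≤ a then t else if t ≤ b then t + d - b else if t ≤ c then t + a + d - b - c
  else if t ≤ d then t + a - c else t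

theorem exists_blocks {w : List ℕ} {a b c d : ℕ} (hab : a ≤ b) (hbc : b ≤ c) (hcd : c ≤ d)
    (hd : d ≤ w.length) : ∃ α β γ δ ε : List ℕ, w = α ++ (β ++ (γ ++ (δ ++ ε))) ∧
      swapBlocks a b c d w = α ++ (δ ++ (γ ++ (β ++ ε))) ∧
      α.length = a ∧ β.length = b - a ∧ γ.length = c - b ∧ δ.length = d - c := by
  refine ⟨w.take a, (w.take b).drop a, (w.take c).drop b, (w.take d).drop c, w.drop d, ?_,
    by simp [swapBlocks], by simp; omega, by simp; omega, by simp; omega, by simp; omega⟩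
  have e : ∀ i j : ℕ, i ≤ j → w.take j = w.take i ++ (w.take j).drop i := by
    intro i j h
    conv_lhs => rw [← List.take_append_drop i (w.take j), List.take_take, min_eq_left h]
  conv_lhs => rw [← List.take_append_drop d w, e c d hcd, e b c hbc, e a b hab]
  simp

theorem swapBlocks_perm {w : List ℕ} {a b c d : ℕ} (hab : a ≤ b) (hbc : b ≤ c) (hcd : c ≤ d)
    (hd : d ≤ w.length) : (swapBlocks a b c d w).Perm w := by
  obtain ⟨α, β, γ, δ, ε, h1, h2, -⟩ := exists_blocks hab hbc hcd hd
  rw [h2, h1, List.perm_iff_count]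
  intro x
  simp only [List.count_append]
  omega

theorem IsArr.of_perm {w v : List ℕ} (hw : IsArr w) (h : v.Perm w) : IsArr v :=
  ⟨h.nodup_iff.2 hw.nodup, fun x => by rw [h.mem_iff, hw.mem, h.length_eq]⟩

theorem idxOf_swapBlocks {w : List ℕ} (hn : w.Nodup) {a b c d : ℕ} (hab : a ≤ b) (hbc : b ≤ c)
    (hcd : c ≤ d) (hd : d ≤ w.length) (x : ℕ) :
    (swapBlocks a b c d w).idxOf x = moveLeft a b c d (w.idxOf x) := by
  obtain ⟨α, β, γ, δ, ε, h1, h2, ha, hb, hc, hd'⟩ := exists_blocks hab hbc hcd hd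
  rw [h2]
  rw [h1] at hn ⊢
  have lt : ∀ {l : List ℕ}, x ∈ l → l.idxOf x < l.length := List.idxOf_lt_length_iff.2
  simp only [List.nodup_append, List.mem_append] at hn
  obtain ⟨-, ⟨-, ⟨-, ⟨-, -, n1⟩, n2⟩, n3⟩, n4⟩ := hn
  unfold moveLeft
  by_cases xa : x ∈ α
  · have := lt xa
    rw [List.idxOf_append_of_mem xa, List.idxOf_append_of_mem xa, if_pos (by omega)]
  rw [List.idxOf_append_of_notMem xa, List.idxOf_append_of_notMem xa, if_neg (by omega)]
  by_cases xb : x ∈ β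
  · have := lt xb
    have xc : x ∉ γ := fun h => n3 x xb x (Or.inl h) rfl
    have xd : x ∉ δ := fun h => n3 x xb x (Or.inr (Or.inl h)) rfl
    rw [List.idxOf_append_of_mem xb, List.idxOf_append_of_notMem xd,
      List.idxOf_append_of_notMem xc, List.idxOf_append_of_mem xb, if_pos (by omega)]
    omega
  rw [List.idxOf_append_of_notMem xb, if_neg (by omega)]
  by_cases xc : x ∈ γ
  · have := lt xc
    have xd : x ∉ δ := fun h => n2 x xc x (Or.inl h) rfl
    rw [List.idxOf_append_of_mem xc, List.idxOf_append_of_notMem xd,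
      List.idxOf_append_of_mem xc, if_pos (by omega)]
    omega
  rw [List.idxOf_append_of_notMem xc, if_neg (by omega)]
  by_cases xd : x ∈ δ
  · have := lt xd
    rw [List.idxOf_append_of_mem xd, List.idxOf_append_of_mem xd, if_pos (by omega)]
    omega
  rw [List.idxOf_append_of_notMem xd, List.idxOf_append_of_notMem xd,
    List.idxOf_append_of_notMem xc, List.idxOf_append_of_notMem xb, if_neg (by omega)]
  omega

theorem leftCut_swapBlocks {w : List ℕ} (hn : w.Nodup) {a b c d : ℕ} (hab : a ≤ b)
    (hbc : b ≤ c) (hcd : c ≤ d) (hd : d ≤ w.length) (x : ℕ) :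
    leftCut (swapBlocks a b c d w) x = moveLeft a b c d (leftCut w x) :=
  idxOf_swapBlocks hn hab hbc hcd hd (x + 1)

theorem rightCut_swapBlocks {w : List ℕ} (hn : w.Nodup) {a b c d : ℕ} (hab : a ≤ b)
    (hbc : b ≤ c) (hcd : c ≤ d) (hd : d ≤ w.length) (x : ℕ) :
    rightCut (swapBlocks a b c d w) x = moveRight a b c d (rightCut w x) := by
  rcases Nat.eq_zero_or_pos x with rfl | hx0
  · simp [rightCut_zero, moveRight]
  · rw [rightCut_eq _ (by omega), rightCut_eq _ (by omega),
      idxOf_swapBlocks hn hab hbc hcd hd x]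
    unfold moveLeft moveRight
    split_ifs <;> omega

/-- `p` and `q` occur in the order `p … q … p … q` in the pointer word of `w`, at the cuts `a`,
`b`, `c`, `d`. -/
structure Interlaced (w : List ℕ) (p q a b c d : ℕ) : Prop where
  fst : a = min (rightCut w p) (leftCut w p)
  snd : b = min (rightCut w q) (leftCut w q)
  trd : c = max (rightCut w p) (leftCut w p)
  fth : d = max (rightCut w q) (leftCut w q)
  lt₁ : min (2 * rightCut w p) (2 * leftCut w p + 1) < min (2 * rightCut w q) (2 * leftCut w q + 1)
  lt₂ : min (2 * rightCut w q) (2 * leftCut w q + 1) < max (2 * rightCut w p) (2 * leftCut w p + 1)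
  lt₃ : max (2 * rightCut w p) (2 * leftCut w p + 1) < max (2 * rightCut w q) (2 * leftCut w q + 1)

theorem Interlaced.le {w : List ℕ} {p q a b c d : ℕ} (h : Interlaced w p q a b c d) :
    a ≤ b ∧ b ≤ c ∧ c ≤ d := by
  obtain ⟨rfl, rfl, rfl, rfl, h1, h2, h3⟩ := h
  omega

theorem cds_comm (p q : ℕ) (w : List ℕ) : cds p q w = cds q p w := by
  simp only [cds, min_comm, max_comm]

theorem cds_eq_swapBlocks {w : List ℕ} {p q a b c d : ℕ} (hp : p ≠ 0) (hq : q ≠ 0)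
    (h : Interlaced w p q a b c d) : cds p q w = swapBlocks a b c d w := by
  have hle := h.le
  have e1 : firstCut w p = a := by rw [h.fst, rightCut_eq _ hp]; rfl
  have e2 : firstCut w q = b := by rw [h.snd, rightCut_eq _ hq]; rfl
  have e3 : secondCut w p = c := by rw [h.trd, rightCut_eq _ hp]; rfl
  have e4 : secondCut w q = d := by rw [h.fth, rightCut_eq _ hq]; rfl
  simp only [cds, e1, e2, e3, e4, min_eq_left hle.1, max_eq_right hle.1, min_eq_left hle.2.2,
    max_eq_right hle.2.2]
  rfl

theorem IsArr.interlaced_of_compatible {w : List ℕ} (hw : IsArr w) {p q : ℕ}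
    (h : Compatible w p q) : (∃ a b c d, Interlaced w p q a b c d) ∨
      ∃ a b c d, Interlaced w q p a b c d := by
  obtain ⟨hpq, hp, hq, h1⟩ := (hw.compatible_iff p q).1 h
  rw [pointers, Finset.mem_Ico] at hp hq
  have n1 : rightCut w p ≠ rightCut w q := fun h => hpq (hw.rightCut_inj hp.2.le h)
  have n2 : leftCut w p ≠ leftCut w q := fun h => hpq (hw.leftCut_inj hp.2.le hq.2.le h)
  rw [inter, ltInd_sum_eq_one (by omega) (by omega) (by omega) (by omega)] at h1
  rcases h1 with ⟨h1, h2, h3⟩ | ⟨h1, h2, h3⟩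
  · exact Or.inl ⟨_, _, _, _, rfl, rfl, rfl, rfl, h1, h2, h3⟩
  · exact Or.inr ⟨_, _, _, _, rfl, rfl, rfl, rfl, h1, h2, h3⟩

/-! ### The effect of a swap on interlacing -/

/-- The effect of `swapBlocks` on the position of a pointer. -/
def movePos (a b c d x : ℕ) : ℕ :=
  if x ≤ 2 * a then x else if x ≤ 2 * b then x + 2 * d - 2 * b
  else if x ≤ 2 * c then x + 2 * a + 2 * d - 2 * b - 2 * c
  else if x ≤ 2 * d then x + 2 * a - 2 * c else x

/-- The even letter at a cut belongs to the entry before it and travels with the preceding block,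
the odd letter with the following one; this is why one map uses `≤` and the other `<`. -/
theorem movePos_two_mul (a b c d t : ℕ) : movePos a b c d (2 * t) = 2 * moveRight a b c d t := by
  unfold movePos moveRight
  split_ifs <;> omega

theorem movePos_two_mul_add_one {a b c d : ℕ} (hbc : b ≤ c) (hcd : c ≤ d) (t : ℕ) :
    movePos a b c d (2 * t + 1) = 2 * moveLeft a b c d t + 1 := by
  unfold movePos moveLeft
  split_ifs <;> omega

theorem movePos_cases {a b c d : ℕ} (hab : a ≤ b) (hbc : b ≤ c) (hcd : c ≤ d) (x : ℕ) :
    (x ≤ 2 * a ∧ movePos a b c d x = x ∧ ltInd (2 * a) x + ltInd (2 * c) x = 0 ∧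
      ltInd (2 * b) x + ltInd (2 * d) x = 0) ∨
    (2 * a < x ∧ x ≤ 2 * b ∧ movePos a b c d x = x + 2 * d - 2 * b ∧
      ltInd (2 * a) x + ltInd (2 * c) x = 1 ∧ ltInd (2 * b) x + ltInd (2 * d) x = 0) ∨
    (2 * b < x ∧ x ≤ 2 * c ∧ movePos a b c d x = x + 2 * a + 2 * d - 2 * b - 2 * c ∧
      ltInd (2 * a) x + ltInd (2 * c) x = 1 ∧ ltInd (2 * b) x + ltInd (2 * d) x = 1) ∨
    (2 * c < x ∧ x ≤ 2 * d ∧ movePos a b c d x = x + 2 * a - 2 * c ∧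
      ltInd (2 * a) x + ltInd (2 * c) x = 0 ∧ ltInd (2 * b) x + ltInd (2 * d) x = 1) ∨
    (2 * d < x ∧ movePos a b c d x = x ∧ ltInd (2 * a) x + ltInd (2 * c) x = 0 ∧
      ltInd (2 * b) x + ltInd (2 * d) x = 0) := by
  have e2 : (1 + 1 : ZMod 2) = 0 := rfl
  unfold movePos
  rcases le_or_gt x (2 * a) with h | h
  · left
    rw [if_pos h, ltInd_eq_zero (by omega), ltInd_eq_zero (by omega), ltInd_eq_zero (by omega),
      ltInd_eq_zero (by omega)]
    simp [h]
  right
  rw [if_neg (by omega)]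
  rcases le_or_gt x (2 * b) with h' | h'
  · left
    rw [if_pos h', ltInd_eq_one (by omega), ltInd_eq_zero (by omega), ltInd_eq_zero (by omega),
      ltInd_eq_zero (by omega)]
    simp [h, h']
  right
  rw [if_neg (by omega)]
  rcases le_or_gt x (2 * c) with h'' | h''
  · left
    rw [if_pos h'', ltInd_eq_one (by omega), ltInd_eq_zero (by omega), ltInd_eq_one (by omega),
      ltInd_eq_zero (by omega)]
    simp [h', h'']
  right
  rw [if_neg (by omega)]
  rcases le_or_gt x (2 * d) with h3 | h3
  · left
    rw [if_pos h3, ltInd_eq_one (by omega), ltInd_eq_one (by omega), ltInd_eq_one (by omega),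
      ltInd_eq_zero (by omega)]
    simp [h'', h3, e2]
  right
  rw [if_neg (by omega), ltInd_eq_one (by omega), ltInd_eq_one (by omega),
    ltInd_eq_one (by omega), ltInd_eq_one (by omega)]
  simp [h3, e2]

/-- Label `x` by `([2a<x]+[2c<x], [2b<x]+[2d<x])`: the blocks `β`, `γ`, `δ` get the three nonzero
vectors `(1,0)`, `(1,1)`, `(0,1)`, the outer ones get zero. Two letters change order exactly when
they lie in different inner blocks, that is, when the alternating form of their labels is `1`. -/
theorem ltInd_movePos {a b c d : ℕ} (hab : a ≤ b) (hbc : b ≤ c) (hcd : c ≤ d) (x y : ℕ) :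
    ltInd (movePos a b c d x) (movePos a b c d y) = ltInd x y +
      (ltInd (2 * a) x + ltInd (2 * c) x) * (ltInd (2 * b) y + ltInd (2 * d) y) +
      (ltInd (2 * b) x + ltInd (2 * d) x) * (ltInd (2 * a) y + ltInd (2 * c) y) := by
  have e2 : (1 + 1 : ZMod 2) = 0 := rfl
  rcases movePos_cases hab hbc hcd x with h | h | h | h | h <;>
    rcases movePos_cases hab hbc hcd y with h' | h' | h' | h' | h' <;>
    simp only [h, h', mul_zero, mul_one, add_zero, add_assoc, e2] <;>
    unfold ltInd <;> split_ifs <;> first | rfl | omega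

/-- The thresholds are doubled cuts, whereas the left letter of `p` sits at an odd position;
comparing with `2l` or with `2l + 1` differs only at `x = 2l + 1`. -/
theorem Interlaced.ltInd_fst {w : List ℕ} {p q a b c d x : ℕ} (h : Interlaced w p q a b c d)
    (hx : x ≠ 2 * leftCut w p + 1) :
    ltInd (2 * a) x + ltInd (2 * c) x =
      ltInd (2 * rightCut w p) x + ltInd (2 * leftCut w p + 1) x := by
  rw [h.fst, h.trd]
  unfold ltInd
  split_ifs <;> first | rfl | omega

theorem Interlaced.ltInd_snd {w : List ℕ} {p q a b c d x : ℕ} (h : Interlaced w p q a b c d)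
    (hx : x ≠ 2 * leftCut w q + 1) :
    ltInd (2 * b) x + ltInd (2 * d) x =
      ltInd (2 * rightCut w q) x + ltInd (2 * leftCut w q + 1) x := by
  rw [h.snd, h.fth]
  unfold ltInd
  split_ifs <;> first | rfl | omega

/-- Sum `ltInd_movePos` over both occurrences of `r` and of `s`. The correction is bilinear, and the
labels of the two occurrences of `r` add up to `(inter w p r, inter w q r)`. -/
theorem IsArr.inter_swapBlocks {w : List ℕ} (hw : IsArr w) {p q a b c d r s : ℕ}
    (h : Interlaced w p q a b c d) (hp : p ≤ w.length) (hq : q ≤ w.length) (hr : r ≤ w.length)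
    (hs : s ≤ w.length) (hrp : r ≠ p) (hrq : r ≠ q) (hsp : s ≠ p) (hsq : s ≠ q) :
    inter (swapBlocks a b c d w) r s =
      inter w r s + inter w p r * inter w q s + inter w q r * inter w p s := by
  have hd : d ≤ w.length := by
    rw [h.fth]
    exact max_le (hw.rightCut_le hq) (leftCut_le w q)
  obtain ⟨hab, hbc, hcd⟩ := h.le
  have nR : ∀ {x y}, x ≤ w.length → x ≠ y → rightCut w x ≠ rightCut w y :=
    fun hx hxy h => hxy (hw.rightCut_inj hx h)
  have nL : ∀ {x y}, x ≤ w.length → y ≤ w.length → x ≠ y → leftCut w x ≠ leftCut w y :=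
    fun hx hy hxy h => hxy (hw.leftCut_inj hx hy h)
  have m1 := nR hr hrp
  have m2 := nR hr hrq
  have m3 := nR hs hsp
  have m4 := nR hs hsq
  have k1 := nL hr hp hrp
  have k2 := nL hr hq hrq
  have k3 := nL hs hp hsp
  have k4 := nL hs hq hsq
  simp only [inter, leftCut_swapBlocks hw.nodup hab hbc hcd hd,
    rightCut_swapBlocks hw.nodup hab hbc hcd hd, ← movePos_two_mul,
    ← movePos_two_mul_add_one hbc hcd, ltInd_movePos hab hbc hcd]
  rw [h.ltInd_fst (x := 2 * rightCut w r) (by omega),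
    h.ltInd_fst (x := 2 * leftCut w r + 1) (by omega),
    h.ltInd_fst (x := 2 * rightCut w s) (by omega),
    h.ltInd_fst (x := 2 * leftCut w s + 1) (by omega),
    h.ltInd_snd (x := 2 * rightCut w r) (by omega),
    h.ltInd_snd (x := 2 * leftCut w r + 1) (by omega),
    h.ltInd_snd (x := 2 * rightCut w s) (by omega),
    h.ltInd_snd (x := 2 * leftCut w s + 1) (by omega)]
  ring

/-! ### The effect of a swap on the cycle permutation -/

/-- Two of the four letters can share a cut only as a right pointer followed by a left pointer,
which explains the pattern of weak inequalities. -/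
theorem Interlaced.cases {w : List ℕ} {p q a b c d : ℕ} (h : Interlaced w p q a b c d) :
    (rightCut w p = a ∧ leftCut w p = c ∧ rightCut w q = b ∧ leftCut w q = d ∧
      a < b ∧ b ≤ c ∧ c < d) ∨
    (rightCut w p = a ∧ leftCut w p = c ∧ rightCut w q = d ∧ leftCut w q = b ∧
      a ≤ b ∧ b < c ∧ c < d) ∨
    (rightCut w p = c ∧ leftCut w p = a ∧ rightCut w q = b ∧ leftCut w q = d ∧
      a < b ∧ b < c ∧ c ≤ d) ∨
    (rightCut w p = c ∧ leftCut w p = a ∧ rightCut w q = d ∧ leftCut w q = b ∧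
      a < b ∧ b < c ∧ c < d) := by
  obtain ⟨ha, hb, hc, hd, l1, l2, l3⟩ := h
  have letters : ∀ r l : ℕ,
      (min r l = r ∧ max r l = l ∧ min (2 * r) (2 * l + 1) = 2 * r ∧
        max (2 * r) (2 * l + 1) = 2 * l + 1) ∨
      (min r l = l ∧ max r l = r ∧ min (2 * r) (2 * l + 1) = 2 * l + 1 ∧
        max (2 * r) (2 * l + 1) = 2 * r) := by
    intro r l
    rcases le_or_gt r l with h | h
    · exact Or.inl ⟨min_eq_left h, max_eq_right h, min_eq_left (by omega),
        max_eq_right (by omega)⟩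
    · exact Or.inr ⟨min_eq_right h.le, max_eq_left h.le, min_eq_right (by omega),
        max_eq_left (by omega)⟩
  rcases letters (rightCut w p) (leftCut w p) with ⟨p1, p2, p3, p4⟩ | ⟨p1, p2, p3, p4⟩ <;>
    rcases letters (rightCut w q) (leftCut w q) with ⟨q1, q2, q3, q4⟩ | ⟨q1, q2, q3, q4⟩ <;>
    simp only [p1, p2, p3, p4, q1, q2, q3, q4] at ha hb hc hd l1 l2 l3
  · exact Or.inl ⟨ha.symm, hc.symm, hb.symm, hd.symm, by omega⟩
  · exact Or.inr (Or.inl ⟨ha.symm, hc.symm, hd.symm, hb.symm, by omega⟩)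
  · exact Or.inr (Or.inr (Or.inl ⟨hc.symm, ha.symm, hb.symm, hd.symm, by omega⟩))
  · exact Or.inr (Or.inr (Or.inr ⟨hc.symm, ha.symm, hd.symm, hb.symm, by omega⟩))

/-- This equality of cuts is the new adjacency about `p`. -/
theorem Interlaced.swap_fst {w : List ℕ} {p q a b c d : ℕ} (h : Interlaced w p q a b c d) :
    moveLeft a b c d (leftCut w p) = moveRight a b c d (rightCut w p) := by
  unfold moveLeft moveRight
  rcases h.cases with ⟨e1, e2, e3, e4, e5⟩ | ⟨e1, e2, e3, e4, e5⟩ | ⟨e1, e2, e3, e4, e5⟩ |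
    ⟨e1, e2, e3, e4, e5⟩ <;>
    simp only [e1, e2, e3, e4] at * <;> split_ifs <;> omega

theorem Interlaced.swap_snd {w : List ℕ} {p q a b c d : ℕ} (h : Interlaced w p q a b c d) :
    moveLeft a b c d (leftCut w q) = moveRight a b c d (rightCut w q) := by
  unfold moveLeft moveRight
  rcases h.cases with ⟨e1, e2, e3, e4, e5⟩ | ⟨e1, e2, e3, e4, e5⟩ | ⟨e1, e2, e3, e4, e5⟩ |
    ⟨e1, e2, e3, e4, e5⟩ <;>
    simp only [e1, e2, e3, e4] at * <;> split_ifs <;> omega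

/-- A cut that is no block boundary keeps its two neighbours together. -/
theorem Interlaced.swap_of_ne {w : List ℕ} {p q a b c d t : ℕ} (h : Interlaced w p q a b c d)
    (h1 : t ≠ leftCut w p) (h2 : t ≠ rightCut w p) (h3 : t ≠ leftCut w q)
    (h4 : t ≠ rightCut w q) : moveLeft a b c d t = moveRight a b c d t := by
  unfold moveLeft moveRight
  rcases h.cases with ⟨e1, e2, e3, e4, e5⟩ | ⟨e1, e2, e3, e4, e5⟩ | ⟨e1, e2, e3, e4, e5⟩ |
    ⟨e1, e2, e3, e4, e5⟩ <;>
    simp only [e1, e2, e3, e4] at * <;> split_ifs <;> omega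

/-- The entry that stood after `p` now meets the entry that stood before `p + 1`, so the predecessor
of `p` in its cycle is sent to the successor of `p`. The excluded coincidences say that `p` and `q`
are consecutive in a cycle. -/
theorem Interlaced.swap_cross_fst {w : List ℕ} {p q a b c d : ℕ} (h : Interlaced w p q a b c d)
    (h1 : rightCut w p ≠ leftCut w q) (h2 : leftCut w p ≠ rightCut w q) :
    moveLeft a b c d (rightCut w p) = moveRight a b c d (leftCut w p) := by
  unfold moveLeft moveRight
  rcases h.cases with ⟨e1, e2, e3, e4, e5⟩ | ⟨e1, e2, e3, e4, e5⟩ | ⟨e1, e2, e3, e4, e5⟩ |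
    ⟨e1, e2, e3, e4, e5⟩ <;>
    simp only [e1, e2, e3, e4] at * <;> split_ifs <;> omega

theorem Interlaced.swap_cross_snd {w : List ℕ} {p q a b c d : ℕ} (h : Interlaced w p q a b c d)
    (h1 : rightCut w q ≠ leftCut w p) (h2 : leftCut w q ≠ rightCut w p) :
    moveLeft a b c d (rightCut w q) = moveRight a b c d (leftCut w q) := by
  unfold moveLeft moveRight
  rcases h.cases with ⟨e1, e2, e3, e4, e5⟩ | ⟨e1, e2, e3, e4, e5⟩ | ⟨e1, e2, e3, e4, e5⟩ |
    ⟨e1, e2, e3, e4, e5⟩ <;>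
    simp only [e1, e2, e3, e4] at * <;> split_ifs <;> omega

/-- Here `q` is the successor of `p` in its cycle; bypassing both leads to the successor of `q`. -/
theorem Interlaced.swap_chain_fst {w : List ℕ} {p q a b c d : ℕ} (h : Interlaced w p q a b c d)
    (h1 : leftCut w p = rightCut w q) :
    moveLeft a b c d (rightCut w p) = moveRight a b c d (leftCut w q) := by
  unfold moveLeft moveRight
  rcases h.cases with ⟨e1, e2, e3, e4, e5⟩ | ⟨e1, e2, e3, e4, e5⟩ | ⟨e1, e2, e3, e4, e5⟩ |
    ⟨e1, e2, e3, e4, e5⟩ <;>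
    simp only [e1, e2, e3, e4] at * <;> split_ifs <;> omega

theorem Interlaced.swap_chain_snd {w : List ℕ} {p q a b c d : ℕ} (h : Interlaced w p q a b c d)
    (h1 : leftCut w q = rightCut w p) :
    moveLeft a b c d (rightCut w q) = moveRight a b c d (leftCut w p) := by
  unfold moveLeft moveRight
  rcases h.cases with ⟨e1, e2, e3, e4, e5⟩ | ⟨e1, e2, e3, e4, e5⟩ | ⟨e1, e2, e3, e4, e5⟩ |
    ⟨e1, e2, e3, e4, e5⟩ <;>
    simp only [e1, e2, e3, e4] at * <;> split_ifs <;> omega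

/-- The cycle permutation after a swap, in terms of the permutation before it. -/
theorem IsArr.cycleC_swapBlocks {w : List ℕ} (hw : IsArr w) {p q a b c d x : ℕ}
    (h : Interlaced w p q a b c d) (hpq : p ≠ q) (hp : p ≤ w.length) (hq : q ≤ w.length)
    (hp' : leftCut w p ≠ rightCut w p) (hq' : leftCut w q ≠ rightCut w q)
    (hx : x ≤ w.length) (hxp : x ≠ p) (hxq : x ≠ q) :
    cycleC (swapBlocks a b c d w) x = bypass (bypass (cycleC w) p) q x := by
  have hd : d ≤ w.length := by
    rw [h.fth]
    exact max_le (hw.rightCut_le hq) (leftCut_le w q)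
  obtain ⟨hab, hbc, hcd⟩ := h.le
  have hperm := swapBlocks_perm hab hbc hcd hd
  have hw' := hw.of_perm hperm
  have key : ∀ {z}, z ≤ w.length → moveLeft a b c d (leftCut w x) =
      moveRight a b c d (rightCut w z) → cycleC (swapBlocks a b c d w) x = z := by
    intro z hz h
    rw [hw'.cycleC_eq_iff (hperm.length_eq ▸ hx), hperm.length_eq,
      leftCut_swapBlocks hw.nodup hab hbc hcd hd, rightCut_swapBlocks hw.nodup hab hbc hcd hd]
    exact ⟨hz, h.symm⟩
  obtain ⟨lx, cx⟩ := hw.cycleC_le hx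
  obtain ⟨lp, cp⟩ := hw.cycleC_le hp
  obtain ⟨lq, cq⟩ := hw.cycleC_le hq
  have ip : cycleC w x ≠ cycleC w p := fun h => hxp ((cycleC w).injective h)
  have iq : cycleC w x ≠ cycleC w q := fun h => hxq ((cycleC w).injective h)
  have ipq : cycleC w p ≠ cycleC w q := fun h => hpq ((cycleC w).injective h)
  have fp : cycleC w p ≠ p := fun h => hp' (by rw [← cp, h])
  have fq : cycleC w q ≠ q := fun h => hq' (by rw [← cq, h])
  have nR : ∀ {y z}, y ≤ w.length → y ≠ z → rightCut w y ≠ rightCut w z :=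
    fun hy hyz h => hyz (hw.rightCut_inj hy h)
  by_cases e1 : cycleC w x = p
  · have b1 : bypass (cycleC w) p x = cycleC w p := if_pos e1
    have e2 : cycleC w q ≠ p := fun h => iq (e1.trans h.symm)
    have b2 : bypass (cycleC w) p q = cycleC w q := if_neg e2
    have x1 : leftCut w x = rightCut w p := by rw [← cx, e1]
    have n1 : leftCut w q ≠ rightCut w p := by rw [← cq]; exact nR lq e2
    by_cases e3 : cycleC w p = q
    · have b3 : bypass (bypass (cycleC w) p) q x = cycleC w q := by
        rw [bypass, if_pos (b1.trans e3), b2]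
      rw [b3]
      apply key lq
      rw [x1, cq]
      exact h.swap_chain_fst (by rw [← cp, e3])
    · have b3 : bypass (bypass (cycleC w) p) q x = cycleC w p := by
        rw [bypass, b1, if_neg e3]
      rw [b3]
      apply key lp
      rw [x1, cp]
      exact h.swap_cross_fst n1.symm (by rw [← cp]; exact nR lp e3)
  · have b1 : bypass (cycleC w) p x = cycleC w x := if_neg e1
    by_cases e2 : cycleC w x = q
    · have x1 : leftCut w x = rightCut w q := by rw [← cx, e2]
      have e3 : cycleC w p ≠ q := fun h => ip (e2.trans h.symm)
      have n1 : leftCut w p ≠ rightCut w q := by rw [← cp]; exact nR lp e3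
      have b3 : bypass (bypass (cycleC w) p) q x = bypass (cycleC w) p q := by
        rw [bypass, if_pos (b1.trans e2)]
      rw [b3]
      by_cases e4 : cycleC w q = p
      · have b2 : bypass (cycleC w) p q = cycleC w p := if_pos e4
        rw [b2]
        apply key lp
        rw [x1, cp]
        exact h.swap_chain_snd (by rw [← cq, e4])
      · have b2 : bypass (cycleC w) p q = cycleC w q := if_neg e4
        rw [b2]
        apply key lq
        rw [x1, cq]
        exact h.swap_cross_snd n1.symm (by rw [← cq]; exact nR lq e4)
    · have b3 : bypass (bypass (cycleC w) p) q x = cycleC w x := by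
        rw [bypass, b1, if_neg e2]
      rw [b3]
      apply key lx
      rw [cx]
      apply h.swap_of_ne
      · rw [← cx, ← cp]; exact nR lx ip
      · rw [← cx]; exact nR lx e1
      · rw [← cx, ← cq]; exact nR lx iq
      · rw [← cx]; exact nR lx e2

/-- Agreement of the maps is needed only where the walk goes. After a swap the walk from `w.length`
avoids `p` and `q`, where the bypass formula is not available. -/
theorem reach_congr {f : Perm ℕ} {g : ℕ → ℕ} {a x : ℕ} (S : ℕ → Prop) (ha : S a)
    (hS : ∀ y, Reach f a y → S y) (h : ∀ y, S y → f y = g y) : Reach f a x ↔ Reach g a x := by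
  constructor
  · intro hx
    induction hx with
    | base => exact h a ha ▸ .base
    | step y hy hy0 ih => exact h y (hS y hy) ▸ .step _ ih hy0
  · intro hx
    induction hx with
    | base => exact (h a ha).symm ▸ .base
    | step y _ hy0 ih => exact (h y (hS y ih)).symm ▸ .step _ ih hy0

/-! ### Legal moves -/

/-- The effect of a legal move. -/
structure IsMove (w : List ℕ) (p q : ℕ) (v : List ℕ) : Prop where
  isArr : IsArr v
  length_eq : v.length = w.length
  hasAdjacency : ∀ r ∈ pointers w.length,
    HasAdjacency w r ∨ r = p ∨ r = q → HasAdjacency v r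
  pile : strategicPile v = strategicPile w \ {p, q}
  pile_nonempty : (strategicPile w).Nonempty → (strategicPile v).Nonempty
  inter_eq : ∀ r s, r ≤ w.length → s ≤ w.length → r ≠ p → r ≠ q → s ≠ p → s ≠ q →
    inter v r s = inter w r s + inter w p r * inter w q s + inter w q r * inter w p s

theorem IsArr.isMove_of_interlaced {w : List ℕ} (hw : IsArr w) {p q a b c d : ℕ}
    (h : Interlaced w p q a b c d) (hc : Compatible w p q) : IsMove w p q (cds p q w) := by
  obtain ⟨hpq, hp, hq, -⟩ := (hw.compatible_iff p q).1 hc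
  have ap := hw.not_hasAdjacency_of_compatible hc
  have aq := hw.not_hasAdjacency_of_compatible hc.symm
  have ap' := (hw.hasAdjacency_iff hp).not.1 ap
  have aq' := (hw.hasAdjacency_iff hq).not.1 aq
  have hp' := Finset.mem_Ico.1 hp
  have hq' := Finset.mem_Ico.1 hq
  rw [cds_eq_swapBlocks (by omega) (by omega) h]
  have hd : d ≤ w.length := by
    rw [h.fth]
    exact max_le (hw.rightCut_le hq'.2.le) (leftCut_le w q)
  obtain ⟨hab, hbc, hcd⟩ := h.le
  have hperm := swapBlocks_perm hab hbc hcd hd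
  have hlen := hperm.length_eq
  have hv := hw.of_perm hperm
  have hC := fun {x} => hw.cycleC_swapBlocks (x := x) h hpq hp'.2.le hq'.2.le ap' aq'
  have adjp : cycleC (swapBlocks a b c d w) p = p := by
    rw [hv.cycleC_eq_iff (by omega), leftCut_swapBlocks hw.nodup hab hbc hcd hd,
      rightCut_swapBlocks hw.nodup hab hbc hcd hd, h.swap_fst]
    exact ⟨by omega, rfl⟩
  have adjq : cycleC (swapBlocks a b c d w) q = q := by
    rw [hv.cycleC_eq_iff (by omega), leftCut_swapBlocks hw.nodup hab hbc hcd hd,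
      rightCut_swapBlocks hw.nodup hab hbc hcd hd, h.swap_snd]
    exact ⟨by omega, rfl⟩
  have hn0 : w.length ≠ 0 := by omega
  have hne : ∀ {y}, Reach (cycleC (swapBlocks a b c d w)) w.length y → y ≠ p ∧ y ≠ q :=
    fun hy => ⟨reach_ne_of_fixed hy adjp (by omega), reach_ne_of_fixed hy adjq (by omega)⟩
  have hreach : ∀ {x}, x ≠ p → x ≠ q → (Reach (cycleC (swapBlocks a b c d w)) w.length x ↔
      Reach (cycleC w) w.length x) := by
    intro x hxp hxq
    rw [reach_congr (g := bypass (bypass (cycleC w) p) q)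
      (fun y => y ≤ w.length ∧ y ≠ p ∧ y ≠ q) ⟨le_rfl, by omega, by omega⟩
      (fun y hy => ⟨hlen ▸ hv.reach_le (hlen.symm ▸ hy), hne hy⟩)
      (fun y hy => hC hy.1 hy.2.1 hy.2.2), reach_bypass_iff (by omega) hxq,
      reach_bypass_iff (by omega) hxp]
  refine ⟨hv, hlen, fun r hr => ?_, ?_, ?_, ?_⟩
  · rw [hv.hasAdjacency_iff_cycleC (hlen.symm ▸ hr), hw.hasAdjacency_iff_cycleC hr]
    by_cases hrp : r = p
    · subst hrp
      simp [adjp]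
    by_cases hrq : r = q
    · subst hrq
      simp [adjq]
    have hr' := Finset.mem_Ico.1 hr
    rw [hC hr'.2.le hrp hrq]
    simp only [hrp, hrq, or_false]
    intro h
    simp [bypass, h, hrp, hrq]
  · ext x
    rw [hv.mem_strategicPile_iff (by omega), hlen, Finset.mem_sdiff,
      hw.mem_strategicPile_iff hn0, hreach (x := 0) (by omega) (by omega), Finset.mem_insert,
      Finset.mem_singleton, not_or]
    constructor
    · rintro ⟨h0, h1, h2⟩
      have := hne h1
      exact ⟨⟨h0, (hreach this.1 this.2).1 h1, h2⟩, this⟩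
    · rintro ⟨⟨h0, h1, h2⟩, h3⟩
      exact ⟨h0, (hreach h3.1 h3.2).2 h1, h2⟩
  · rw [hv.strategicPile_nonempty_iff (by omega), hw.strategicPile_nonempty_iff hn0, hlen,
      hreach (x := 0) (by omega) (by omega)]
    exact id
  · intro r s hr hs h1 h2 h3 h4
    exact hw.inter_swapBlocks h hp'.2.le hq'.2.le hr hs h1 h2 h3 h4

theorem IsMove.symm {w v : List ℕ} {p q : ℕ} (h : IsMove w p q v) : IsMove w q p v where
  isArr := h.isArr
  length_eq := h.length_eq
  hasAdjacency r hr h' := h.hasAdjacency r hr (h'.imp_right Or.symm)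
  pile := by rw [h.pile, Finset.pair_comm]
  pile_nonempty := h.pile_nonempty
  inter_eq r s hr hs h1 h2 h3 h4 := by
    rw [h.inter_eq r s hr hs h2 h1 h4 h3]
    ring

theorem IsArr.isMove {w : List ℕ} (hw : IsArr w) {p q : ℕ} (h : Compatible w p q) :
    IsMove w p q (cds p q w) := by
  rcases hw.interlaced_of_compatible h with ⟨a, b, c, d, h'⟩ | ⟨a, b, c, d, h'⟩
  · exact hw.isMove_of_interlaced h' h
  · rw [cds_comm]
    exact (hw.isMove_of_interlaced h' h.symm).symm

/-! ### Isolated pointers and fixed points of the game -/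

theorem iff_of_iff_succ {S : ℕ → Prop} {n r : ℕ} (hr1 : 1 ≤ r) (hrn : r < n)
    (h : ∀ s, 1 ≤ s → s < n → s ≠ r → (S s ↔ S (s + 1))) {y : ℕ} (hy1 : 1 ≤ y) (hyn : y ≤ n) :
    (y ≤ r → (S y ↔ S r)) ∧ (r + 1 ≤ y → (S y ↔ S (r + 1))) := by
  constructor
  · intro hyr
    have : ∀ k, y ≤ k → k ≤ r → (S y ↔ S k) := by
      intro k hk
      induction k, hk using Nat.le_induction with
      | base => exact fun _ => Iff.rfl
      | succ k hk ih =>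
        intro hkr
        exact (ih (by omega)).trans (h k (by omega) (by omega) (by omega))
    exact this r hyr le_rfl
  · intro hyr
    have : ∀ k, r + 1 ≤ k → k ≤ n → (S k ↔ S (r + 1)) := by
      intro k hk
      induction k, hk using Nat.le_induction with
      | base => exact fun _ => Iff.rfl
      | succ k hk ih =>
        intro hkr
        exact (h k (by omega) (by omega) (by omega)).symm.trans (ih (by omega))
    exact this y hyr hyn

/-- A pointer without an adjacency about it that is not compatible with any pointer spans the
whole permutation. -/
theorem IsArr.cuts_of_isolated {w : List ℕ} (hw : IsArr w) {r : ℕ} (hr : r ∈ pointers w.length)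
    (hiso : ∀ s, ¬ Compatible w r s) (hadj : ¬ HasAdjacency w r) :
    leftCut w r = 0 ∧ rightCut w r = w.length := by
  rw [hw.hasAdjacency_iff hr] at hadj
  have hr' := Finset.mem_Ico.1 hr
  have hR := rightCut_eq w (y := r) (by omega)
  have hL : leftCut w r = w.idxOf (r + 1) := rfl
  have hlt := hw.idxOf_lt hr'.1 hr'.2.le
  have hsep : ∀ s, 1 ≤ s → s < w.length → s ≠ r → w.idxOf s ≠ w.idxOf r ∧
      w.idxOf (s + 1) ≠ w.idxOf (r + 1) ∧
      ¬((min (2 * (w.idxOf r + 1)) (2 * w.idxOf (r + 1) + 1) <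
            min (2 * (w.idxOf s + 1)) (2 * w.idxOf (s + 1) + 1) ∧
          min (2 * (w.idxOf s + 1)) (2 * w.idxOf (s + 1) + 1) <
            max (2 * (w.idxOf r + 1)) (2 * w.idxOf (r + 1) + 1) ∧
          max (2 * (w.idxOf r + 1)) (2 * w.idxOf (r + 1) + 1) <
            max (2 * (w.idxOf s + 1)) (2 * w.idxOf (s + 1) + 1)) ∨
        (min (2 * (w.idxOf s + 1)) (2 * w.idxOf (s + 1) + 1) <
            min (2 * (w.idxOf r + 1)) (2 * w.idxOf (r + 1) + 1) ∧
          min (2 * (w.idxOf r + 1)) (2 * w.idxOf (r + 1) + 1) <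
            max (2 * (w.idxOf s + 1)) (2 * w.idxOf (s + 1) + 1) ∧
          max (2 * (w.idxOf s + 1)) (2 * w.idxOf (s + 1) + 1) <
            max (2 * (w.idxOf r + 1)) (2 * w.idxOf (r + 1) + 1))) := by
    intro s h1 h2 hs
    have n1 : w.idxOf s ≠ w.idxOf r := fun h =>
      hs ((List.idxOf_inj ((hw.mem s).2 ⟨h1, h2.le⟩)).1 h)
    have n2 : w.idxOf (s + 1) ≠ w.idxOf (r + 1) := fun h =>
      hs (by simpa using (List.idxOf_inj ((hw.mem (s + 1)).2 ⟨by omega, h2⟩)).1 h)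
    refine ⟨n1, n2, ?_⟩
    have hn := (hw.compatible_iff r s).not.1 (hiso s)
    rw [← ltInd_sum_eq_one (by omega) (by omega) (by omega) (by omega)]
    intro h
    refine hn ⟨hs.symm, hr, Finset.mem_Ico.2 ⟨h1, h2⟩, ?_⟩
    rwa [inter, hR, rightCut_eq w (y := s) (by omega)]
  have hmem : ∀ i (hi : i < w.length), 1 ≤ w[i] ∧ w[i] ≤ w.length ∧ w.idxOf w[i] = i := by
    intro i hi
    have := (hw.mem w[i]).1 (List.getElem_mem _)
    exact ⟨this.1, this.2, hw.nodup.idxOf_getElem i hi⟩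
  rw [hL, hR] at hadj ⊢
  -- The occurrences of `r` bound an interval of entries. A pointer `s ≠ r` does not interlace with
  -- `r`, so `s` and `s + 1` are both inside or both outside. Hence membership is constant on `{1,
  -- …, r}` and on `{r + 1, …, w.length}`. In the first case `r` and `r + 1` are inside, so
  -- everything is.
  rcases lt_or_gt_of_ne hadj with h | h
  · have key : ∀ y, 1 ≤ y → y ≤ w.length →
        w.idxOf (r + 1) ≤ w.idxOf y ∧ w.idxOf y < w.idxOf r + 1 := by
      intro y hy1 hyn
      have := iff_of_iff_succ
        (S := fun s => w.idxOf (r + 1) ≤ w.idxOf s ∧ w.idxOf s < w.idxOf r + 1) hr'.1 hr'.2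
        (fun s h1 h2 hs => by
          obtain ⟨n1, n2, n3⟩ := hsep s h1 h2 hs
          rw [min_eq_right (by omega : 2 * w.idxOf (r + 1) + 1 ≤ 2 * (w.idxOf r + 1)),
            max_eq_left (by omega : 2 * w.idxOf (r + 1) + 1 ≤ 2 * (w.idxOf r + 1))] at n3
          omega) hy1 hyn
      rcases Nat.lt_or_ge r y with hy | hy
      · exact (this.2 hy).2 (by omega)
      · exact (this.1 hy).2 (by omega)
    obtain ⟨a1, a2, a3⟩ := hmem 0 (by omega)
    obtain ⟨b1, b2, b3⟩ := hmem (w.length - 1) (by omega)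
    have := key _ a1 a2
    have := key _ b1 b2
    omega
  -- Now `r` and `r + 1` are both outside, so everything is; but the entry after `r` is inside.
  · exfalso
    have hlt' := hw.idxOf_lt (x := r + 1) (by omega) hr'.2
    obtain ⟨a1, a2, a3⟩ := hmem (w.idxOf r + 1) (by omega)
    have := iff_of_iff_succ
      (S := fun s => w.idxOf r + 1 ≤ w.idxOf s ∧ w.idxOf s < w.idxOf (r + 1)) hr'.1 hr'.2
      (fun s h1 h2 hs => by
        obtain ⟨n1, n2, n3⟩ := hsep s h1 h2 hs
        rw [min_eq_left (by omega : 2 * (w.idxOf r + 1) ≤ 2 * w.idxOf (r + 1) + 1),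
          max_eq_right (by omega : 2 * (w.idxOf r + 1) ≤ 2 * w.idxOf (r + 1) + 1)] at n3
        omega) a1 a2
    rcases Nat.lt_or_ge r w[w.idxOf r + 1] with hy | hy
    · have := (this.2 hy).1 ⟨a3.ge, by omega⟩
      omega
    · have := (this.1 hy).1 ⟨a3.ge, by omega⟩
      omega

theorem IsArr.cuts_of_isolated_of_mem_pile {w : List ℕ} (hw : IsArr w) {a : ℕ}
    (ha : a ∈ strategicPile w) (hiso : ∀ s, ¬ Compatible w a s) :
    leftCut w a = 0 ∧ rightCut w a = w.length :=
  hw.cuts_of_isolated (strategicPile_subset w ha) hiso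
    ((hw.hasAdjacency_iff_cycleC (strategicPile_subset w ha)).not.2 (hw.cycleC_ne_of_mem_pile ha))

/-- Since `a` spans the whole word, the walk is `w.length → a → 0`. -/
theorem IsArr.strategicPile_eq_singleton {w : List ℕ} (hw : IsArr w) {a : ℕ}
    (ha : a ∈ strategicPile w) (hiso : ∀ s, ¬ Compatible w a s) : strategicPile w = {a} := by
  obtain ⟨hL, hR⟩ := hw.cuts_of_isolated_of_mem_pile ha hiso
  have ha' := Finset.mem_Ico.1 (strategicPile_subset w ha)
  have c1 : cycleC w w.length = a := by
    rw [hw.cycleC_eq_iff le_rfl, hw.leftCut_length]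
    exact ⟨ha'.2.le, hR⟩
  have c2 : cycleC w a = 0 := by
    rw [hw.cycleC_eq_iff ha'.2.le, hL]
    exact ⟨Nat.zero_le _, rightCut_zero w⟩
  refine Finset.eq_singleton_iff_unique_mem.2 ⟨ha, fun x hx => ?_⟩
  have hx' := (hw.mem_strategicPile_iff (length_ne_zero_of_mem_pile ha)).1 hx
  have : ∀ y, Reach (cycleC w) w.length y → y = a ∨ y = 0 := by
    intro y hy
    induction hy with
    | base => exact Or.inl c1
    | step y _ hy0 ih =>
      rw [ih.resolve_right hy0]
      exact Or.inr c2
  exact (this x hx'.2.1).resolve_right hx'.2.2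

/-- Right cuts are distinct, so only `a` can span the whole word. Every other pointer has an
adjacency, which leaves two runs: `a + 1, …` from the start and `…, a` at the end. -/
theorem IsArr.eq_sigma_of_isFixedPoint {w : List ℕ} (hw : IsArr w) {a : ℕ}
    (ha : a ∈ strategicPile w) (hfix : IsFixedPoint w) : w = sigma w.length a := by
  obtain ⟨hL, hR⟩ := hw.cuts_of_isolated_of_mem_pile ha (hfix a)
  have ha' := Finset.mem_Ico.1 (strategicPile_subset w ha)
  have hadj : ∀ s, 1 ≤ s → s < w.length → s ≠ a → w.idxOf (s + 1) = w.idxOf s + 1 := by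
    intro s h1 h2 hs
    have hs' := Finset.mem_Ico.2 ⟨h1, h2⟩
    by_contra h
    have := (hw.cuts_of_isolated hs' (hfix s) (by
      rw [hw.hasAdjacency_iff hs', rightCut_eq _ (by omega)]; exact h)).2
    exact hs (hw.rightCut_inj h2.le (this.trans hR.symm))
  have hup : ∀ x, a + 1 ≤ x → x ≤ w.length → w.idxOf x + (a + 1) = x := by
    intro x hx
    induction x, hx using Nat.le_induction with
    | base => intro _; rw [show w.idxOf (a + 1) = 0 from hL]; omega
    | succ x hx ih =>
      intro hxn
      have := ih (by omega)
      have := hadj x (by omega) hxn (by omega)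
      omega
  rw [rightCut_eq _ (by omega)] at hR
  have hdown : ∀ j, j < a → w.idxOf (a - j) + 1 + j = w.length := by
    intro j
    induction j with
    | zero => intro _; simpa using hR
    | succ j ih =>
      intro hj
      have := ih (by omega)
      have h2 := hadj (a - (j + 1)) (by omega) (by omega) (by omega)
      rw [show a - (j + 1) + 1 = a - j by omega] at h2
      omega
  apply List.ext_getElem
  · simp only [sigma, List.length_append, List.length_range']
    omega
  · intro i h1 h2
    have hget : ∀ x, x ∈ w → w.idxOf x = i → w[i] = x := by
      rintro x hx rfl
      exact List.getElem_idxOf _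
    simp only [sigma, List.getElem_append, List.length_range', List.getElem_range']
    split_ifs with hi
    · apply hget
      · rw [hw.mem]; omega
      · have := hup (a + 1 + 1 * i) (by omega) (by omega)
        omega
    · apply hget
      · rw [hw.mem]; omega
      · have := hdown (w.length - 1 - i) (by omega)
        rw [show a - (w.length - 1 - i) = 1 + 1 * (i - (w.length - a)) by omega] at this
        omega

/-! ### Good permutations under moves -/

theorem zmod_two_eq_of_iff {x y : ZMod 2} (h : x = 1 ↔ y = 1) : x = y := by
  revert x y
  decide

theorem IsGood.inter_eq {w : List ℕ} (hw : IsArr w) {P : Finset ℕ} (h : IsGood w P)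
    (hP : P ⊆ pointers w.length) {r s z : ℕ} (hr : r ∈ P) (hs : s ∈ P)
    (hz : z ∈ pointers w.length) (hzr : z ≠ r) (hzs : z ≠ s) : inter w z r = inter w z s := by
  have := h.same r hr s hs z hz hzr hzs
  rw [hw.compatible_iff, hw.compatible_iff] at this
  apply zmod_two_eq_of_iff
  simpa [hz, hP hr, hP hs, hzr, hzs] using this

theorem IsGood.mem_pile {w : List ℕ} (hw : IsArr w) {P : Finset ℕ} (h : IsGood w P) {p q : ℕ}
    (hc : Compatible w p q) : p ∈ strategicPile w :=
  h.pile p ((hw.compatible_iff p q).1 hc).2.1 (hw.not_hasAdjacency_of_compatible hc)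

/-- For twins `r`, `s` the two correction terms of the pivot coincide and cancel. For twins `s`, `t`
and a third pointer, the updates use the same row entries, so equality of rows persists. Only `p`
and `q` leave the pile, and both now have adjacencies. -/
theorem IsGood.move {w v : List ℕ} (hw : IsArr w) {P : Finset ℕ} (h : IsGood w P)
    (hP : P ⊆ pointers w.length) {p q : ℕ} (hc : Compatible w p q) (hm : IsMove w p q v) :
    IsGood v (P \ {p, q}) := by
  obtain ⟨hpq, hp, hq, -⟩ := (hw.compatible_iff p q).1 hc
  have hle : ∀ {x}, x ∈ pointers w.length → x ≤ w.length := fun hx => (Finset.mem_Ico.1 hx).2.le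
  have hmem : ∀ {x}, x ∈ P \ {p, q} → x ∈ P ∧ x ≠ p ∧ x ≠ q := by
    intro x hx
    simpa using hx
  refine ⟨fun r hr s hs hrs => ?_, fun s hs t ht r hr hrs hrt => ?_, fun r hr hadj => ?_⟩
  · obtain ⟨hr, hrp, hrq⟩ := hmem hr
    obtain ⟨hs, hsp, hsq⟩ := hmem hs
    rw [hm.isArr.compatible_iff, hm.length_eq]
    refine ⟨hrs, hP hr, hP hs, ?_⟩
    rw [hm.inter_eq r s (hle (hP hr)) (hle (hP hs)) hrp hrq hsp hsq,
      h.inter_eq hw hP hr hs hp hrp.symm hsp.symm, h.inter_eq hw hP hr hs hq hrq.symm hsq.symm,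
      mul_comm (inter w q s), add_assoc, CharTwo.add_self_eq_zero, add_zero]
    exact ((hw.compatible_iff r s).1 (h.pairwise r hr s hs hrs)).2.2.2
  · obtain ⟨ht, htp, htq⟩ := hmem ht
    obtain ⟨hs, hsp, hsq⟩ := hmem hs
    rw [hm.length_eq] at hr
    -- A pointer just played has an adjacency, so it is compatible with nothing.
    by_cases hrpq : r = p ∨ r = q
    · have hadj := hm.hasAdjacency r hr (Or.inr hrpq)
      exact ⟨fun h => absurd hadj (hm.isArr.not_hasAdjacency_of_compatible h),
        fun h => absurd hadj (hm.isArr.not_hasAdjacency_of_compatible h)⟩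
    rw [not_or] at hrpq
    rw [hm.isArr.compatible_iff, hm.isArr.compatible_iff, hm.length_eq,
      hm.inter_eq r s (hle hr) (hle (hP hs)) hrpq.1 hrpq.2 hsp hsq,
      hm.inter_eq r t (hle hr) (hle (hP ht)) hrpq.1 hrpq.2 htp htq,
      h.inter_eq hw hP hs ht hp hsp.symm htp.symm, h.inter_eq hw hP hs ht hq hsq.symm htq.symm,
      h.inter_eq hw hP hs ht hr hrs hrt]
    simp [hrs, hrt, hr, hP hs, hP ht]
  · rw [hm.length_eq] at hr
    have h1 : ¬ (HasAdjacency w r ∨ r = p ∨ r = q) := fun h => hadj (hm.hasAdjacency r hr h)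
    rw [not_or] at h1
    rw [hm.pile, Finset.mem_sdiff]
    exact ⟨h.pile r hr h1.1, by simpa using h1.2⟩

/-- A position of the game with a set `P` of twins inside the strategic pile. -/
structure GoodPosition (w : List ℕ) (P : Finset ℕ) : Prop where
  isArr : IsArr w
  good : IsGood w P
  sub : P ⊆ strategicPile w
  nonempty : (strategicPile w).Nonempty

theorem GoodPosition.move {w : List ℕ} {P : Finset ℕ} (h : GoodPosition w P) {p q : ℕ}
    (hc : Compatible w p q) : GoodPosition (cds p q w) (P \ {p, q}) := by
  have hm := h.isArr.isMove hc
  refine ⟨hm.isArr, h.good.move h.isArr (h.sub.trans (strategicPile_subset w)) hc hm, ?_,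
    hm.pile_nonempty h.nonempty⟩
  rw [hm.pile]
  exact Finset.sdiff_subset_sdiff h.sub le_rfl

theorem GoodPosition.pair_subset {w : List ℕ} {P : Finset ℕ} (h : GoodPosition w P) {p q : ℕ}
    (hc : Compatible w p q) : {p, q} ⊆ strategicPile w :=
  Finset.insert_subset (h.good.mem_pile h.isArr hc)
    (Finset.singleton_subset_iff.2 (h.good.mem_pile h.isArr hc.symm))

theorem GoodPosition.card_pile_cds {w : List ℕ} {P : Finset ℕ} (h : GoodPosition w P) {p q : ℕ}
    (hc : Compatible w p q) :
    (strategicPile (cds p q w)).card + 2 = (strategicPile w).card := by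
  rw [(h.isArr.isMove hc).pile, ← Finset.card_pair hc.1]
  exact Finset.card_sdiff_add_card_eq_card (h.pair_subset hc)

/-- Any legal pair consists of two pile elements, and an isolated pile element is the whole pile. -/
theorem GoodPosition.isFixedPoint_iff {w : List ℕ} {P : Finset ℕ} (h : GoodPosition w P) :
    IsFixedPoint w ↔ (strategicPile w).card = 1 := by
  constructor
  · intro hf
    obtain ⟨a, ha⟩ := h.nonempty
    rw [h.isArr.strategicPile_eq_singleton ha (hf a), Finset.card_singleton]
  · intro h1 p q hc
    have := Finset.card_le_card (h.pair_subset hc)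
    rw [Finset.card_pair hc.1] at this
    omega

theorem GoodPosition.exists_sigma {w : List ℕ} {P A : Finset ℕ} (h : GoodPosition w P)
    (hf : IsFixedPoint w) (hA : (strategicPile w ∩ A).Nonempty) :
    ∃ a ∈ A, w = sigma w.length a := by
  obtain ⟨a, ha⟩ := hA
  rw [Finset.mem_inter] at ha
  exact ⟨a, ha.2, h.isArr.eq_sigma_of_isFixedPoint ha.1 hf⟩

theorem GoodPosition.exists_compatible {w : List ℕ} {P : Finset ℕ} (h : GoodPosition w P)
    (h2 : (strategicPile w).card ≠ 1) {p : ℕ} (hp : p ∈ strategicPile w) :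
    ∃ q, Compatible w p q := by
  by_contra! hiso
  rw [h.isArr.strategicPile_eq_singleton hp hiso, Finset.card_singleton] at h2
  exact h2 rfl

/-! ### The winning strategy of ONE -/

/-- The positions, with ONE to move, that ONE keeps. -/
def OnePosition (A : Finset ℕ) (w : List ℕ) : Prop :=
  ∃ P, GoodPosition w P ∧ 3 * (strategicPile w \ P).card < P.card ∧
    (strategicPile w).card / 2 + 1 + 2 * (strategicPile w \ P).card ≤ (strategicPile w ∩ A).card

/-- The positions, with TWO to move, that ONE keeps. -/
def TwoPosition (A : Finset ℕ) (w : List ℕ) : Prop :=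
  (IsFixedPoint w → ∃ a ∈ A, w = sigma w.length a) ∧
    ∀ p q, Compatible w p q → OnePosition A (cds p q w)

theorem card_le_card_sdiff_pair_add_two (S : Finset ℕ) (p q : ℕ) :
    S.card ≤ (S \ {p, q}).card + 2 := by
  have h1 := Finset.card_le_card_sdiff_add_card (s := S) (t := {p, q})
  have h2 := Finset.card_le_two (a := p) (b := q)
  omega

theorem sdiff_sdiff_pair (S P T : Finset ℕ) : (S \ T) \ (P \ T) = (S \ P) \ T := by
  ext x
  simp only [Finset.mem_sdiff]
  tauto

theorem sdiff_inter_right (S T A : Finset ℕ) : (S \ T) ∩ A = (S ∩ A) \ T := by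
  ext x
  simp only [Finset.mem_sdiff, Finset.mem_inter]
  tauto

/-- TWO can remove two elements of `P` and two of `A`, while half the pile drops by one: hence
margins of `2` and of `1` over the bounds of `OnePosition`. If the pile is `P`, or lies in `A`, this
persists and no margin is needed for that bound. -/
theorem GoodPosition.twoPosition {w : List ℕ} {P A : Finset ℕ} (h : GoodPosition w P)
    (h1 : strategicPile w = P ∨ 3 * (strategicPile w \ P).card + 2 < P.card)
    (h2 : (strategicPile w = P ∧ strategicPile w ⊆ A) ∨
      (strategicPile w).card / 2 + 2 + 2 * (strategicPile w \ P).card ≤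
        (strategicPile w ∩ A).card) : TwoPosition A w := by
  constructor
  · intro hf
    apply h.exists_sigma hf
    rcases h2 with h2 | h2
    · rw [Finset.inter_eq_left.2 h2.2]
      exact h.nonempty
    · rw [← Finset.card_pos]
      omega
  · intro p q hc
    have hm := h.move hc
    have hcard := h.card_pile_cds hc
    have hpile := (h.isArr.isMove hc).pile
    have hpos := hm.nonempty.card_pos
    have hPc := card_le_card_sdiff_pair_add_two P p q
    have hAc := card_le_card_sdiff_pair_add_two (strategicPile w ∩ A) p q
    have hd : (strategicPile (cds p q w) \ (P \ {p, q})).card ≤ (strategicPile w \ P).card := by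
      rw [hpile, sdiff_sdiff_pair]
      exact Finset.card_le_card Finset.sdiff_subset
    have hS : strategicPile w = P → P \ {p, q} = strategicPile (cds p q w) := fun h => by
      rw [hpile, h]
    have hAS : (strategicPile w ∩ A) \ {p, q} = strategicPile (cds p q w) ∩ A := by
      rw [hpile, sdiff_inter_right]
    rw [hAS] at hAc
    refine ⟨_, hm, ?_, ?_⟩
    · rcases h1 with h1 | h1
      · rw [hS h1, Finset.sdiff_self, Finset.card_empty]
        omega
      · omega
    · rcases h2 with h2 | h2
      · have : strategicPile (cds p q w) ⊆ A := by
          rw [hpile]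
          exact Finset.sdiff_subset.trans h2.2
        rw [hS h2.1, Finset.sdiff_self, Finset.card_empty, Finset.inter_eq_left.2 this]
        omega
      · omega

theorem OnePosition.exists_sigma {w : List ℕ} {A : Finset ℕ} (h : OnePosition A w)
    (hf : IsFixedPoint w) : ∃ a ∈ A, w = sigma w.length a := by
  obtain ⟨P, hP, -, h2⟩ := h
  apply hP.exists_sigma hf
  rw [← Finset.card_pos]
  omega

theorem OnePosition.exists_move {w : List ℕ} {A : Finset ℕ} (h : OnePosition A w)
    (hf : ¬ IsFixedPoint w) : ∃ p q, Compatible w p q ∧ TwoPosition A (cds p q w) := by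
  obtain ⟨P, hP, h1, h2⟩ := h
  rw [hP.isFixedPoint_iff] at hf
  have hS0 := hP.nonempty.card_pos
  rcases (strategicPile w \ P).eq_empty_or_nonempty with hQ | ⟨q, hq⟩
  · have hSP : strategicPile w = P := (Finset.sdiff_eq_empty_iff_subset.1 hQ).antisymm hP.sub
    rw [hQ, Finset.card_empty] at h2
    have hclique : ∀ T ⊆ strategicPile w, T.card = 2 →
        ∃ p q, Compatible w p q ∧ T = {p, q} := by
      intro T hT hT2
      obtain ⟨p, q, hpq, rfl⟩ := Finset.card_eq_two.1 hT2
      rw [hSP] at hT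
      exact ⟨p, q, hP.good.pairwise p (hT (by simp)) q (hT (by simp)) hpq, rfl⟩
    have hS' : ∀ {p q}, Compatible w p q → strategicPile (cds p q w) = P \ {p, q} := fun hc => by
      rw [(hP.isArr.isMove hc).pile, hSP]
    rcases Nat.lt_or_ge (strategicPile w \ A).card 2 with hB | hB
    -- At most one pile element is outside `A`: pad these to a pair, after whose removal the whole
    -- pile is in `A`.
    · obtain ⟨T, hBT, hTS, hT2⟩ := Finset.exists_subsuperset_card_eq
        (Finset.sdiff_subset : strategicPile w \ A ⊆ strategicPile w) hB.le (by omega)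
      obtain ⟨p, q, hc, rfl⟩ := hclique T hTS hT2
      refine ⟨p, q, hc, (hP.move hc).twoPosition (Or.inl (hS' hc)) (Or.inl ⟨hS' hc, ?_⟩)⟩
      rw [(hP.isArr.isMove hc).pile]
      intro x hx
      rw [Finset.mem_sdiff] at hx
      by_contra hxA
      exact hx.2 (hBT (Finset.mem_sdiff.2 ⟨hx.1, hxA⟩))
    · obtain ⟨T, hTB, hT2⟩ := Finset.exists_subset_card_eq hB
      obtain ⟨p, q, hc, rfl⟩ := hclique T (hTB.trans Finset.sdiff_subset) hT2
      refine ⟨p, q, hc, (hP.move hc).twoPosition (Or.inl (hS' hc)) (Or.inr ?_)⟩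
      have hcard := hP.card_pile_cds hc
      have e : strategicPile (cds p q w) ∩ A = strategicPile w ∩ A := by
        rw [(hP.isArr.isMove hc).pile, sdiff_inter_right, Finset.sdiff_eq_self_iff_disjoint]
        refine Finset.disjoint_left.2 fun x hx hx' => ?_
        exact (Finset.mem_sdiff.1 (hTB hx')).2 (Finset.mem_inter.1 hx).2
      rw [e, hS' hc, Finset.sdiff_self, Finset.card_empty, ← hS' hc]
      omega
  -- Playing `q ∉ P` with any partner lowers `c` by at least one and costs at most one element of
  -- `P` and two of `A`; the bounds `3c` and `2c` pay for exactly this plus the margins for TWO's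
  -- reply.
  · have hq' := Finset.mem_sdiff.1 hq
    obtain ⟨s, hc⟩ := hP.exists_compatible hf hq'.1
    have hcard := hP.card_pile_cds hc
    have hpile := (hP.isArr.isMove hc).pile
    have hd : (strategicPile (cds q s w) \ (P \ {q, s})).card + 1 ≤
        (strategicPile w \ P).card := by
      rw [hpile, sdiff_sdiff_pair]
      refine Finset.card_lt_card ⟨Finset.sdiff_subset, fun h => ?_⟩
      exact (Finset.mem_sdiff.1 (h hq)).2 (by simp)
    have hPc : P.card ≤ (P \ {q, s}).card + 1 := by
      have e : P \ {q, s} = P.erase s := by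
        ext x
        simp only [Finset.mem_sdiff, Finset.mem_insert, Finset.mem_singleton, Finset.mem_erase]
        constructor
        · tauto
        · rintro ⟨h3, h4⟩
          refine ⟨h4, ?_⟩
          rintro (rfl | rfl)
          exacts [hq'.2 h4, h3 rfl]
      rw [e]
      have := Finset.pred_card_le_card_erase (a := s) (s := P)
      omega
    have hAc := card_le_card_sdiff_pair_add_two (strategicPile w ∩ A) q s
    rw [← sdiff_inter_right, ← hpile] at hAc
    exact ⟨q, s, hc, (hP.move hc).twoPosition (Or.inr (by omega)) (Or.inr (by omega))⟩

open Classical in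
/-- A strategy of ONE that leads to a position in `TwoPosition A` whenever possible. -/
noncomputable def keepStrategy (A : Finset ℕ) : Strategy := fun w _ =>
  if h : ∃ x : ℕ × ℕ, Compatible w x.1 x.2 ∧ TwoPosition A (cds x.1 x.2 w) then h.choose
  else (0, 0)

theorem OnePosition.keepStrategy_spec {A : Finset ℕ} {w : List ℕ} (h : OnePosition A w)
    (hf : ¬ IsFixedPoint w) (l : List (List ℕ)) :
    Compatible w (keepStrategy A w l).1 (keepStrategy A w l).2 ∧
      TwoPosition A (cds (keepStrategy A w l).1 (keepStrategy A w l).2 w) := by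
  have : ∃ x : ℕ × ℕ, Compatible w x.1 x.2 ∧ TwoPosition A (cds x.1 x.2 w) := by
    obtain ⟨p, q, h⟩ := h.exists_move hf
    exact ⟨(p, q), h⟩
  rw [keepStrategy, dif_pos this]
  exact this.choose_spec

theorem OnePosition.oneHasWinningStrategy {A : Finset ℕ} {w₀ : List ℕ} (h₀ : OnePosition A w₀) :
    OneHasWinningStrategy w₀ A := by
  have key : ∀ w h, Play (keepStrategy A) w₀ w h → (IsArr w ∧ w.length = w₀.length) ∧
      (Even h.length → OnePosition A w) ∧ (Odd h.length → TwoPosition A w) := by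
    intro w h hp
    induction hp with
    | start =>
      refine ⟨⟨?_, rfl⟩, fun _ => h₀, fun h => by simp at h⟩
      obtain ⟨_, hP, -⟩ := h₀
      exact hP.isArr
    | one w h _ he hc ih =>
      have hm := ih.1.1.isMove hc
      refine ⟨⟨hm.isArr, hm.length_eq.trans ih.1.2⟩, fun h' => ?_, fun _ => ?_⟩
      · rw [List.length_cons, Nat.even_add_one] at h'
        exact absurd he h'
      · exact ((ih.2.1 he).keepStrategy_spec (fun hf => hf _ _ hc) h).2
    | two w h p q _ ho hc ih =>
      have hm := ih.1.1.isMove hc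
      refine ⟨⟨hm.isArr, hm.length_eq.trans ih.1.2⟩, fun _ => (ih.2.2 ho).2 p q hc, fun h' => ?_⟩
      rw [List.length_cons, Nat.odd_add_one] at h'
      exact absurd ho h'
  refine ⟨keepStrategy A, fun w h hp => ⟨fun he hf => ?_, fun hf => ?_⟩⟩
  · exact (((key w h hp).2.1 he).keepStrategy_spec hf h).1
  · obtain ⟨⟨-, hl⟩, h1, h2⟩ := key w h hp
    rw [← hl]
    rcases Nat.even_or_odd h.length with he | ho
    · exact (h1 he).exists_sigma hf
    · exact (h2 ho).1 hf

theorem IsGood.oneHasWinningStrategy {w : List ℕ} (hw : IsArr w) {P A : Finset ℕ} {c : ℕ}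
    (h : IsGood w P) (hk : (strategicPile w).card = P.card + c)
    (hc : 3 * c < P.card) (hA : A ⊆ strategicPile w)
    (hcard : (strategicPile w).card / 2 + 1 + 2 * c ≤ A.card) : OneHasWinningStrategy w A := by
  apply OnePosition.oneHasWinningStrategy
  have hne : (strategicPile w).Nonempty := by
    rw [← Finset.card_pos]
    omega
  -- With fewer than two elements `P` need not lie in the pile, since pairwise compatibility is
  -- vacuous. Then `|P| = 1`, `c = 0`, and the one-element pile itself serves as the good set.
  rcases Nat.lt_or_ge P.card 2 with h1 | h2
  · have hone : (strategicPile w).card = 1 := by omega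
    obtain ⟨a, ha⟩ := Finset.card_eq_one.1 hone
    refine ⟨strategicPile w, ⟨hw, ⟨fun p hp q hq hpq => ?_, fun p hp q hq r _ _ _ => ?_, h.pile⟩,
      subset_rfl, hne⟩, ?_, ?_⟩
    · rw [ha, Finset.mem_singleton] at hp hq
      exact absurd (hp.trans hq.symm) hpq
    · rw [ha, Finset.mem_singleton] at hp hq
      rw [hp, hq]
    · rw [Finset.sdiff_self, Finset.card_empty]
      omega
    · rw [Finset.sdiff_self, Finset.card_empty, Finset.inter_eq_right.2 hA]
      omega
  · have hsub : P ⊆ strategicPile w := by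
      intro p hp
      obtain ⟨q, hq, hpq⟩ := Finset.exists_mem_ne h2 p
      exact h.mem_pile hw (h.pairwise p hp q hq hpq.symm)
    have := Finset.card_sdiff_add_card_eq_card hsub
    refine ⟨P, ⟨hw, h, hsub, hne⟩, by omega, ?_⟩
    rw [Finset.inter_eq_right.2 hA]
    omega

/-! ### Parity of the number of compatible pointers -/

theorem IsArr.sum_rightCut {w : List ℕ} (hw : IsArr w) (g : ℕ → ZMod 2) :
    ∑ s ∈ Finset.range (w.length + 1), g (rightCut w s) =
      ∑ t ∈ Finset.range (w.length + 1), g t := by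
  refine Finset.sum_nbij (rightCut w) (fun s hs => ?_) (fun s hs t _ h => ?_) (fun t ht => ?_)
    fun _ _ => rfl
  · exact Finset.mem_range_succ_iff.2 (hw.rightCut_le (Finset.mem_range_succ_iff.1 hs))
  · exact hw.rightCut_inj (Finset.mem_range_succ_iff.1 hs) h
  · obtain ⟨y, hy, h⟩ := hw.exists_rightCut (Finset.mem_range_succ_iff.1 ht)
    exact ⟨y, Finset.mem_range_succ_iff.2 hy, h⟩

theorem IsArr.sum_leftCut {w : List ℕ} (hw : IsArr w) (g : ℕ → ZMod 2) :
    ∑ s ∈ Finset.range (w.length + 1), g (leftCut w s) =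
      ∑ t ∈ Finset.range (w.length + 1), g t := by
  refine Finset.sum_nbij (leftCut w) (fun s _ => ?_) (fun s hs t ht h => ?_) (fun t ht => ?_)
    fun _ _ => rfl
  · exact Finset.mem_range_succ_iff.2 (leftCut_le w s)
  · exact hw.leftCut_inj (Finset.mem_range_succ_iff.1 hs) (Finset.mem_range_succ_iff.1 ht) h
  · obtain ⟨y, hy, h⟩ := hw.exists_leftCut (Finset.mem_range_succ_iff.1 ht)
    exact ⟨y, Finset.mem_range_succ_iff.2 hy, h⟩

theorem ltInd_even_add (r t : ℕ) :
    ltInd (2 * r) (2 * t) + ltInd (2 * r) (2 * t + 1) = if t = r then 1 else 0 := by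
  have e2 : (1 + 1 : ZMod 2) = 0 := rfl
  rcases lt_trichotomy r t with h | rfl | h
  · rw [ltInd_eq_one (by omega), ltInd_eq_one (by omega), if_neg h.ne', e2]
  · rw [ltInd_eq_zero le_rfl, ltInd_eq_one (by omega), if_pos rfl, zero_add]
  · rw [ltInd_eq_zero (by omega), ltInd_eq_zero (by omega), if_neg h.ne, add_zero]

theorem ltInd_odd_add (l t : ℕ) :
    ltInd (2 * l + 1) (2 * t) + ltInd (2 * l + 1) (2 * t + 1) = 0 := by
  have e2 : (1 + 1 : ZMod 2) = 0 := rfl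
  rcases Nat.lt_or_ge l t with h | h
  · rw [ltInd_eq_one (by omega), ltInd_eq_one (by omega), e2]
  · rw [ltInd_eq_zero (by omega), ltInd_eq_zero (by omega), add_zero]

/-- Both kinds of cut run over all of `{0, …, w.length}`, so the letters can be grouped by cut. The
pair `2t`, `2t + 1` contributes zero unless a letter `p` separates it, which happens only at `t =
rightCut w p`. -/
theorem IsArr.sum_inter {w : List ℕ} (hw : IsArr w) {p : ℕ} (hp : p ≤ w.length) :
    ∑ s ∈ Finset.range (w.length + 1), inter w p s = 1 := by
  simp only [inter, Finset.sum_add_distrib]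
  rw [hw.sum_rightCut fun t => ltInd (2 * rightCut w p) (2 * t),
    hw.sum_leftCut fun t => ltInd (2 * rightCut w p) (2 * t + 1),
    hw.sum_rightCut fun t => ltInd (2 * leftCut w p + 1) (2 * t),
    hw.sum_leftCut fun t => ltInd (2 * leftCut w p + 1) (2 * t + 1),
    ← Finset.sum_add_distrib, ← Finset.sum_add_distrib]
  simp only [ltInd_even_add, ltInd_odd_add, Finset.sum_const_zero, add_zero]
  rw [Finset.sum_ite_eq' (Finset.range (w.length + 1)) (rightCut w p) fun _ => (1 : ZMod 2),
    if_pos (Finset.mem_range_succ_iff.2 (hw.rightCut_le hp))]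

theorem inter_self (w : List ℕ) (p : ℕ) : inter w p p = 1 := by
  rw [inter, ltInd_eq_zero le_rfl, ltInd_eq_zero le_rfl, zero_add, add_zero]
  rcases Nat.lt_or_ge (leftCut w p) (rightCut w p) with h | h
  · rw [ltInd_eq_zero (by omega), ltInd_eq_one (by omega), zero_add]
  · rw [ltInd_eq_one (by omega), ltInd_eq_zero (by omega), add_zero]

open Classical in
/-- If the entry `n` stands directly to the left of the entry `1`, then every pointer is
compatible with an even number of pointers. -/
theorem IsArr.even_card_compatible {w : List ℕ} (hw : IsArr w)
    (hC : leftCut w 0 = rightCut w w.length) {p : ℕ} (hp : p ∈ pointers w.length) :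
    Even ((pointers w.length).filter (Compatible w p)).card := by
  have hp' := Finset.mem_Ico.1 hp
  have hsum := hw.sum_inter hp'.2.le
  rw [Finset.sum_range_succ, Finset.range_eq_Ico,
    Finset.sum_eq_sum_Ico_succ_bot (by omega : 0 < w.length)] at hsum
  -- The letter of `0` at position `0` contributes nothing and the last letter contributes `1`
  -- twice. The remaining letters of `0` and `w.length` sit at one cut, unseparated by `p`, so they
  -- cancel.
  have hends : inter w p 0 + inter w p w.length = 0 := by
    have n1 : rightCut w p ≠ rightCut w w.length := fun h =>
      hp'.2.ne (hw.rightCut_inj hp'.2.le h)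
    have n2 : leftCut w p ≠ leftCut w 0 := fun h =>
      (by omega : p ≠ 0) (hw.leftCut_inj hp'.2.le (Nat.zero_le _) h)
    have l1 := hw.rightCut_le hp'.2.le
    have l2 := hw.leftCut_lt hp'.2
    have e1 : ltInd (2 * rightCut w p) (2 * rightCut w w.length + 1) =
        ltInd (2 * rightCut w p) (2 * rightCut w w.length) := by
      unfold ltInd
      split_ifs <;> first | rfl | omega
    have e2 : ltInd (2 * leftCut w p + 1) (2 * rightCut w w.length + 1) =
        ltInd (2 * leftCut w p + 1) (2 * rightCut w w.length) := by
      unfold ltInd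
      split_ifs <;> first | rfl | omega
    rw [inter, inter, rightCut_zero, hw.leftCut_length, hC, e1, e2,
      ltInd_eq_zero (Nat.zero_le (2 * rightCut w p)),
      ltInd_eq_zero (Nat.zero_le (2 * leftCut w p + 1)),
      ltInd_eq_one (by omega : 2 * rightCut w p < 2 * w.length + 1),
      ltInd_eq_one (by omega : 2 * leftCut w p + 1 < 2 * w.length + 1)]
    generalize ltInd (2 * rightCut w p) (2 * rightCut w w.length) = x
    generalize ltInd (2 * leftCut w p + 1) (2 * rightCut w w.length) = y
    revert x y
    decide
  have hmid : ∑ s ∈ pointers w.length, inter w p s = 1 := by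
    rw [pointers]
    linear_combination hsum - hends
  rw [← Finset.add_sum_erase _ _ hp, inter_self, add_eq_left] at hmid
  have hcard : ((pointers w.length).filter (Compatible w p)) =
      ((pointers w.length).erase p).filter fun s => inter w p s = 1 := by
    ext s
    rw [Finset.mem_filter, Finset.mem_filter, Finset.mem_erase, hw.compatible_iff]
    constructor
    · rintro ⟨h1, h2, -, -, h3⟩
      exact ⟨⟨h2.symm, h1⟩, h3⟩
    · rintro ⟨⟨h1, h2⟩, h3⟩
      exact ⟨h2, h1.symm, hp, h2, h3⟩
  rw [← ZMod.natCast_eq_zero_iff_even, hcard, ← Finset.sum_boole]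
  refine (Finset.sum_congr rfl fun s _ => ?_).trans hmid
  generalize inter w p s = x
  revert x
  decide

/-! ### Maximal strategic piles with few missing contexts -/

open Classical in
theorem sum_card_compatible (w : List ℕ) :
    ∑ p ∈ pointers w.length, ((pointers w.length).filter (Compatible w p)).card =
      2 * numContexts w := by
  set V := pointers w.length with hV
  have h1 : ∑ p ∈ V, (V.filter (Compatible w p)).card =
      ((V ×ˢ V).filter fun x => Compatible w x.1 x.2).card := by
    simp only [Finset.card_filter, Finset.sum_product]
  have h2 : ((V ×ˢ V).filter fun x => Compatible w x.1 x.2) =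
      ((V ×ˢ V).filter fun x => x.1 < x.2 ∧ Compatible w x.1 x.2) ∪
        ((V ×ˢ V).filter fun x => x.2 < x.1 ∧ Compatible w x.1 x.2) := by
    ext x
    simp only [Finset.mem_union, Finset.mem_filter]
    constructor
    · rintro ⟨hx, hc⟩
      rcases lt_or_gt_of_ne hc.1 with h | h
      · exact Or.inl ⟨hx, h, hc⟩
      · exact Or.inr ⟨hx, h, hc⟩
    · rintro (⟨hx, -, hc⟩ | ⟨hx, -, hc⟩) <;> exact ⟨hx, hc⟩
  have h3 : ((V ×ˢ V).filter fun x => x.2 < x.1 ∧ Compatible w x.1 x.2).card =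
      ((V ×ˢ V).filter fun x => x.1 < x.2 ∧ Compatible w x.1 x.2).card := by
    refine Finset.card_nbij' Prod.swap Prod.swap ?_ ?_ (fun _ _ => rfl) fun _ _ => rfl <;>
    · intro x hx
      simp only [Finset.coe_filter, Finset.mem_product, Set.mem_ofPred_eq, Prod.fst_swap,
        Prod.snd_swap] at hx ⊢
      exact ⟨hx.1.symm, hx.2.1, hx.2.2.symm⟩
  rw [h1, h2, Finset.card_union_of_disjoint, h3, numContexts, two_mul]
  rw [Finset.disjoint_left]
  intro x hx hx'
  exact (Finset.mem_filter.1 hx).2.1.not_gt (Finset.mem_filter.1 hx').2.1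

/-- The walk from `w.length` reaches everything below `w.length` and never steps out of `0`. So the
image of `0` can only be `w.length` itself. -/
theorem IsArr.leftCut_zero_of_pile_eq {w : List ℕ} (hw : IsArr w) (h0 : w.length ≠ 0)
    (hne : (strategicPile w).Nonempty) (h : strategicPile w = pointers w.length) :
    leftCut w 0 = rightCut w w.length := by
  obtain ⟨hle, hC⟩ := hw.cycleC_le (Nat.zero_le w.length)
  suffices cycleC w 0 = w.length by rw [← hC, this]
  by_contra hn
  have hr := (hw.strategicPile_nonempty_iff h0).1 hne
  have hreach : ∀ y, y < w.length → Reach (cycleC w) w.length y := by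
    intro y hy
    rcases Nat.eq_zero_or_pos y with rfl | hy0
    · exact hr
    · have : y ∈ strategicPile w := h ▸ Finset.mem_Ico.2 ⟨hy0, hy⟩
      exact ((hw.mem_strategicPile_iff h0).1 this).2.1
  have hpre : ∀ y, Reach (cycleC w) w.length y → y ≠ cycleC w 0 := by
    intro y hy he
    cases hy with
    | base => exact h0 ((cycleC w).injective he)
    | step x _ hx0 => exact hx0 ((cycleC w).injective he)
  exact hpre _ (hreach _ (by omega)) rfl

-- The exceptional set `T` consists of the pointers that miss a partner. All other pointers are
-- compatible with everything, hence are twins and form a clique.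
open Classical in
theorem IsArr.oneHasWinningStrategy_of_numContexts {w : List ℕ} (hw : IsArr w) {n b : ℕ}
    (hlen : w.length = 2 * n) (hb : 4 * b + 1 < 2 * n)
    (hpile : (strategicPile w).card + 1 = w.length)
    (hnum : (2 * n - 1).choose 2 ≤ numContexts w + b) {A : Finset ℕ}
    (hA : A ⊆ strategicPile w) (hcard : n + 2 * b ≤ A.card) : OneHasWinningStrategy w A := by
  have hVcard : (pointers w.length).card + 1 = w.length := by
    rw [pointers, Nat.card_Ico]
    omega
  have hSP : strategicPile w = pointers w.length :=
    Finset.eq_of_subset_of_card_le (strategicPile_subset w) (by omega)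
  have hne : (strategicPile w).Nonempty := by
    rw [← Finset.card_pos]
    omega
  have hC := hw.leftCut_zero_of_pile_eq (by omega) hne hSP
  have heven := fun {p} => hw.even_card_compatible hC (p := p)
  have hsum := sum_card_compatible w
  set V := pointers w.length with hV
  have hsub : ∀ p, V.filter (Compatible w p) ⊆ V.erase p := by
    intro p s hs
    rw [Finset.mem_filter] at hs
    exact Finset.mem_erase.2 ⟨hs.2.1.symm, hs.1⟩
  set T := V.filter fun p => (V.filter (Compatible w p)).card + 2 < 2 * n with hT
  have hbound : ∀ p ∈ V, (V.filter (Compatible w p)).card + (if p ∈ T then 2 else 0) ≤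
      2 * n - 2 := by
    intro p hp
    have h1 := Finset.card_le_card (hsub p)
    rw [Finset.card_erase_of_mem hp] at h1
    -- The degree is even and below `2n - 2`, so it is at most `2n - 4`.
    split_ifs with h
    · obtain ⟨m, hm⟩ := heven hp
      have := (Finset.mem_filter.1 h).2
      omega
    · omega
  have hTV : T ⊆ V := Finset.filter_subset _ _
  have hTb : T.card ≤ b := by
    -- The degrees sum to twice the number of contexts. Each member of `T` costs two, and the total
    -- deficit is at most `2b`.
    have h1 := Finset.sum_le_sum hbound
    rw [Finset.sum_add_distrib, hsum, ← Finset.sum_filter, Finset.filter_mem_eq_inter,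
      Finset.inter_eq_right.2 hTV, Finset.sum_const, Finset.sum_const, smul_eq_mul, smul_eq_mul,
      show V.card = 2 * n - 1 by omega] at h1
    have h2 : 2 * (2 * n - 1).choose 2 = (2 * n - 1) * (2 * n - 2) := by
      rw [Nat.choose_two_right, Nat.mul_div_cancel' (Nat.even_mul_pred_self _).two_dvd,
        Nat.sub_sub]
    omega
  have hfull : ∀ p ∈ V \ T, ∀ q ∈ V, q ≠ p → Compatible w p q := by
    intro p hp q hq hqp
    rw [Finset.mem_sdiff] at hp
    have h1 : ¬ (V.filter (Compatible w p)).card + 2 < 2 * n := fun h =>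
      hp.2 (Finset.mem_filter.2 ⟨hp.1, h⟩)
    have h2 : V.filter (Compatible w p) = V.erase p := by
      apply Finset.eq_of_subset_of_card_le (hsub p)
      rw [Finset.card_erase_of_mem hp.1]
      omega
    have h3 : q ∈ V.filter (Compatible w p) := h2 ▸ Finset.mem_erase.2 ⟨hqp, hq⟩
    exact (Finset.mem_filter.1 h3).2
  have hgood : IsGood w (V \ T) := by
    refine ⟨fun p hp q hq hpq => hfull p hp q (Finset.sdiff_subset hq) hpq.symm,
      fun p hp q hq r hr hrp hrq => ?_, fun p hp _ => hSP ▸ hp⟩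
    exact iff_of_true (hfull p hp r hr hrp).symm (hfull q hq r hr hrq).symm
  have hcV := Finset.card_sdiff_add_card_eq_card hTV
  refine hgood.oneHasWinningStrategy hw (c := T.card) ?_ ?_ hA ?_
  · rw [hSP, hcV]
  · omega
  · omega

theorem winning_of_contexts {b n : ℕ} (hn : (2 * n - 1 - b : ℤ) > 3 * b)
    (π : Equiv.Perm (Fin (2 * n))) (A : Finset ℕ) (hmax : HasMaximalPile (oneLine π))
    (hnum : ((2 * n - 1).choose 2 : ℤ) - b ≤ numContexts (oneLine π))
    (hA : A ⊆ strategicPile (oneLine π)) (hcard : n + 2 * b ≤ A.card) :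
    OneHasWinningStrategy (oneLine π) A := by
  have hlen := length_oneLine π
  refine (isArr_oneLine π).oneHasWinningStrategy_of_numContexts (b := b) hlen (by omega) ?_
    (by omega) hA hcard
  rcases hmax with h | h
  · exact h.2
  · exact absurd h.1 (by rw [hlen, Nat.not_odd_iff_even]; exact even_two_mul n)

theorem exists_bound_of_half_lt {r : ℝ} (hr : 1 / 2 < r) (b : ℕ) : ∃ N : ℕ, ∀ n : ℕ, N ≤ n →
    (2 * n - 1 - b : ℤ) > 3 * b ∧ (n + 2 * b : ℝ) ≤ r * (2 * n - 1) := by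
  -- The inequality `n + 2b ≤ r(2n - 1)` is `r + 2b ≤ n(2r - 1)`; the summand `2b + 1` added to `N`
  -- below secures the integer condition.
  obtain ⟨N, hN⟩ := exists_nat_ge ((r + 2 * b) / (2 * r - 1))
  refine ⟨N + 2 * b + 1, fun n hn => ⟨by omega, ?_⟩⟩
  have h1 : (N : ℝ) ≤ n := by exact_mod_cast (by omega : N ≤ n)
  have h2 := (div_le_iff₀ (by linarith)).1 (hN.trans h1)
  linarith

end ContextSwap

theorem mainTheorem12 :
    (∀ (n k c : ℕ) (π : Equiv.Perm (Fin n)) (P A : Finset ℕ),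
      P ⊆ ContextSwap.pointers n →
      ContextSwap.IsGood (ContextSwap.oneLine π) P →
      (ContextSwap.strategicPile (ContextSwap.oneLine π)).card = k →
      k = P.card + c →
      3 * c < P.card →
      A ⊆ ContextSwap.strategicPile (ContextSwap.oneLine π) →
      k / 2 + 1 + 2 * c ≤ A.card →
      ContextSwap.OneHasWinningStrategy (ContextSwap.oneLine π) A) ∧
    (∀ (b n : ℕ), 0 < b → (2 * n - 1 - b : ℤ) > 3 * b →
      ∀ (π : Equiv.Perm (Fin (2 * n))) (A : Finset ℕ),
      ContextSwap.HasMaximalPile (ContextSwap.oneLine π) →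
      ((2 * n - 1).choose 2 : ℤ) - b ≤ ContextSwap.numContexts (ContextSwap.oneLine π) →
      A ⊆ ContextSwap.strategicPile (ContextSwap.oneLine π) →
      n + 2 * b ≤ A.card →
      ContextSwap.OneHasWinningStrategy (ContextSwap.oneLine π) A) ∧
    (∀ b : ℕ, 0 < b → ∀ r : ℝ, 1 / 2 < r → ∃ N : ℕ, ∀ n : ℕ, N ≤ n →
      ∀ (π : Equiv.Perm (Fin (2 * n))) (A : Finset ℕ),
      ContextSwap.HasMaximalPile (ContextSwap.oneLine π) →
      ((2 * n - 1).choose 2 : ℤ) - b ≤ ContextSwap.numContexts (ContextSwap.oneLine π) →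
      A ⊆ ContextSwap.strategicPile (ContextSwap.oneLine π) →
      r * ((ContextSwap.strategicPile (ContextSwap.oneLine π)).card : ℝ) ≤ A.card →
      ContextSwap.OneHasWinningStrategy (ContextSwap.oneLine π) A) := by
  refine ⟨fun n k c π P A _ hgood hk hkc hc hA hcard => ?_, fun b n _ hn π A hmax hnum hA hcard =>
    ContextSwap.winning_of_contexts hn π A hmax hnum hA hcard, fun b _ r hr => ?_⟩
  · exact hgood.oneHasWinningStrategy (ContextSwap.isArr_oneLine π)
      (hk.trans hkc) hc hA (by rwa [hk])
  · obtain ⟨N, hN⟩ := ContextSwap.exists_bound_of_half_lt hr b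
    refine ⟨N, fun n hn π A hmax hnum hA hcard => ?_⟩
    obtain ⟨h1, h2⟩ := hN n hn
    refine ContextSwap.winning_of_contexts h1 π A hmax hnum hA ?_
    have hlen := ContextSwap.length_oneLine π
    have hS : (ContextSwap.strategicPile (ContextSwap.oneLine π)).card + 1 = 2 * n := by
      rcases hmax with h | h
      · exact h.2.trans hlen
      · exact absurd h.1 (by rw [hlen, Nat.not_odd_iff_even]; exact even_two_mul n)
    have hS' : ((ContextSwap.strategicPile (ContextSwap.oneLine π)).card : ℝ) = 2 * n - 1 := by
      rw [eq_sub_iff_add_eq]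
      exact_mod_cast hS
    rw [hS'] at hcard
    exact_mod_cast h2.trans hcard
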